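/- Definitions. Let $G=\langle V,E\rangle$ be a finite directed graph. A \emph{feedback arc set} of $G$ is a set $F\subseteq E$ containing at least one arc of every directed cycle of $G$. An \emph{acyclic Hamiltonian partition} of $G$ is a partition $\pi$ of $V$ such that, for every $P\in\pi$, the subgraph of $G$ induced by $P$ has a (directed) Hamiltonian path, and such that the digraph on $\pi$ with an arc from $P$ to $Q$ ($P\ne Q$) whenever $G$ has an arc from a vertex of $P$ to a vertex of $Q$ is acyclic. The \emph{size} of $\pi$ is its number of classes. FAS is the decision problem: given a digraph $G=\langle V,E\rangle$ and a positive integer $K\le |V|$, does $G$ have a feedback arc set of size at most $K$? AHP is the decision problem: given an acyclic digraph $G=\langle V,E\rangle$ and a positive integer $K\le|V|$, does $G$ have an acyclic Hamiltonian partition of size at most $K$? Instances are encoded as binary words by the number of vertices in unary, the adjacency matrix and $K$ in unary. For a one-to-one function $e:E\to\{1,\dots,|E|\}$ let $P(G,e)$ be the digraph whose vertices are the pairwise distinct symbols $v_{i,j}$ ($v\in V$, $0\le i,j\le |E|$) and the arcs $\langle v,u\rangle\in E$ (as additional "glue" vertices), and whose arcs are $$\langle v_{i,j},v_{i,j+1}\rangle\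 (0\le i\le|E|,\ 0\le j<|E|),\qquad \langle v_{i,j},v_{i+1,j}\rangle\ (0\le i<|E|,\ 0\le j\le|E|)$$ for $v\in V$, and $$\langle\langle v,u\rangle, v_{e(\langle v,u\rangle),0}\rangle,\qquad \langle\langle v,u\rangle, u_{0,e(\langle v,u\rangle)}\rangle$$ for $\langle v,u\rangle\in E$. Theorem. (1) Let $G=\langle V,E\rangle$ be a finite digraph with $V\neq\emptyset$, without self-loops, in which every vertex has in-degree equal to $1$ or out-degree equal to $1$, and let $e:E\to\{1,\dots,|E|\}$ be one-to-one. Then $P(G,e)$ is acyclic and, for every integer $k\ge0$, $G$ has a feedback arc set of size at most $k$ if and only if $P(G,e)$ has an acyclic Hamiltonian partition of size at most $k+|V|\cdot(|E|+1)$. (2) FAS restricted to digraphs without self-loops in which every vertex has in-degree equal to $1$ or out-degree equal to $1$ is logspace many-one reducible to AHP. More precisely, there is a map from instances of this restricted problem to instances of AHP which preserves the answer, is computed by a deterministic Turing machine with a read-only input tape, a write-only output tape and work tapes on which only $O(\log n)$ cells are used on inputs of length $n$, and sends $(G,k)$ to $(P(G,e),\,k+|V|\cdot(|E|+1))$ for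 some one-to-one $e:E\to\{1,\dots,|E|\}$ (depending on $G$), up to a numbering of the vertices of $P(G,e)$. -/

import Mathlib

namespace AHP

universe u

/-! ### Directed graphs, cycles, feedback arc sets -/

section Digraphs

variable {V : Type u}

/-- A directed cycle with `m + 1` pairwise distinct vertices `c 0, …, c m`; the addition in
`Fin (m + 1)` wraps around. A self-loop is a cycle with `m = 0`. -/
def IsDirectedCycle (G : Digraph V) {m : ℕ} (c : Fin (m + 1) → V) : Prop :=
  Function.Injective c ∧ ∀ i, G.Adj (c i) (c (i + 1))

/-- `G` has no directed cycle (finite acyclic digraphs are the DAGs). -/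
def IsAcyclic (G : Digraph V) : Prop :=
  ∀ (m : ℕ) (c : Fin (m + 1) → V), ¬ IsDirectedCycle G c

/-- The arcs of `G`. -/
abbrev Arc (G : Digraph V) : Type u := {a : V × V // G.Adj a.1 a.2}

/-- The number of arcs of a finite digraph. -/
noncomputable def numArcs (G : Digraph V) : ℕ := Nat.card (Arc G)

/-- A feedback arc set: a set of arcs containing at least one arc of each directed cycle. -/
def IsFeedbackArcSet (G : Digraph V) (F : Set (V × V)) : Prop :=
  (∀ a ∈ F, G.Adj a.1 a.2) ∧
    ∀ (m : ℕ) (c : Fin (m + 1) → V), IsDirectedCycle G c → ∃ i, (c i, c (i + 1)) ∈ F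

/-- `G` has a feedback arc set of size at most `K`. -/
def HasFeedbackArcSet (G : Digraph V) (K : ℕ) : Prop :=
  ∃ F : Set (V × V), IsFeedbackArcSet G F ∧ F.encard ≤ K

/-- No self-loops, and every vertex has in-degree equal to 1 or out-degree equal to 1. -/
def IsRestricted (G : Digraph V) : Prop :=
  (∀ v, ¬ G.Adj v v) ∧
    ∀ v, {u | G.Adj u v}.encard = 1 ∨ {u | G.Adj v u}.encard = 1

/-! ### Acyclic Hamiltonian partitions -/

/-- The subgraph of `G` induced by `P` has a Hamiltonian path. -/
def HasHamiltonianPathOn (G : Digraph V) (P : Set V) : Prop :=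
  ∃ l : List V, l.Nodup ∧ (∀ v, v ∈ l ↔ v ∈ P) ∧ l.IsChain G.Adj

/-- The digraph on the classes of `π`, with an arc from `P` to a different class `Q` whenever `G`
has an arc from a vertex of `P` to a vertex of `Q`. -/
def quotientDigraph (G : Digraph V) (π : Set (Set V)) : Digraph π where
  Adj P Q := P ≠ Q ∧ ∃ v ∈ P.1, ∃ w ∈ Q.1, G.Adj v w

/-- A partition of the vertices into sets that induce subgraphs with a Hamiltonian path, such that
the digraph on its classes is acyclic. -/
def IsAcyclicHamiltonianPartition (G : Digraph V) (π : Set (Set V)) : Prop :=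
  Setoid.IsPartition π ∧ (∀ P ∈ π, HasHamiltonianPathOn G P) ∧ IsAcyclic (quotientDigraph G π)

/-- `G` has an acyclic Hamiltonian partition with at most `K` classes. -/
def HasAcyclicHamiltonianPartition (G : Digraph V) (K : ℕ) : Prop :=
  ∃ π : Set (Set V), IsAcyclicHamiltonianPartition G π ∧ π.encard ≤ K

/-! ### The digraph `P(G, e)` -/

/-- A one-to-one function from the arcs of `G` to `{1, …, |E|}`. -/
def IsArcNumbering (G : Digraph V) (e : Arc G → ℕ) : Prop :=
  Function.Injective e ∧ ∀ a, 1 ≤ e a ∧ e a ≤ numArcs G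

/-- The vertices of `P(G, e)`: the gadget vertices `v_{i,j}` with `v ∈ V`, `0 ≤ i, j ≤ |E|`, and
one glue vertex for each arc of `G`. -/
inductive PVertex (G : Digraph V) : Type u
  | grid (v : V) (i j : Fin (numArcs G + 1)) : PVertex G
  | glue (a : Arc G) : PVertex G

/-- The arcs of `P(G, e)`: inside each gadget from `v_{i,j}` to `v_{i,j+1}` and to `v_{i+1,j}`, and
from the glue vertex of an arc `a = (v, u)` to `v_{e(a),0}` and to `u_{0,e(a)}`. -/
inductive PAdj (G : Digraph V) (e : Arc G → ℕ) : PVertex G → PVertex G → Prop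
  | row (v : V) (i j j' : Fin (numArcs G + 1)) (h : (j' : ℕ) = j + 1) :
      PAdj G e (.grid v i j) (.grid v i j')
  | column (v : V) (i i' j : Fin (numArcs G + 1)) (h : (i' : ℕ) = i + 1) :
      PAdj G e (.grid v i j) (.grid v i' j)
  | toTail (a : Arc G) (i : Fin (numArcs G + 1)) (h : (i : ℕ) = e a) :
      PAdj G e (.glue a) (.grid a.1.1 i 0)
  | toHead (a : Arc G) (j : Fin (numArcs G + 1)) (h : (j : ℕ) = e a) :
      PAdj G e (.glue a) (.grid a.1.2 0 j)

/-- The digraph `P(G, e)`. -/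
def P (G : Digraph V) (e : Arc G → ℕ) : Digraph (PVertex G) where
  Adj := PAdj G e

end Digraphs

/-! ### Turing machines with a read-only input tape, work tapes and a write-only output tape -/

/-- The input word is enclosed between two end markers. -/
inductive InputSymbol
  | leftEnd
  | bit (b : Bool)
  | rightEnd

/-- Head movements on a tape whose cells are numbered `0, 1, 2, …`. -/
inductive Move
  | left
  | stay
  | right

/-- The new head position; a head on cell `0` that is told to move left stays there. -/
def Move.apply : Move → ℕ → ℕ
  | .left, p => p - 1
  | .stay, p => p
  | .right, p => p + 1

/-- The symbol in cell `p` of the input tape: cell `0` has the left end marker, cells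
`1, …, w.length` have the word `w`, and cell `w.length + 1` has the right end marker. -/
def readInput (w : List Bool) : ℕ → InputSymbol
  | 0 => .leftEnd
  | p + 1 => match w[p]? with
    | some b => .bit b
    | none => .rightEnd

/-- What a machine with states `Q`, work alphabet `Γ` and work tapes `T` does in one step. -/
structure Action (Q Γ T : Type) where
  next : Q
  inputMove : Move
  write : T → Γ
  workMove : T → Move
  /-- the symbol appended to the output, if any -/
  output : Option Bool

/-- A deterministic Turing machine with a read-only input tape, finitely many work tapes (infinite
to the right) and a write-only output tape. It halts where the transition function is `none`. -/
structure Machine where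
  Q : Type
  Γ : Type
  T : Type
  finiteQ : Finite Q
  finiteΓ : Finite Γ
  finiteT : Finite T
  start : Q
  blank : Γ
  δ : Q → InputSymbol → (T → Γ) → Option (Action Q Γ T)

namespace Machine

variable (M : Machine)

/-- Configurations: state, position of the input head, contents and head positions of the work
tapes, and the output produced so far. -/
structure Cfg where
  state : M.Q
  inputPos : ℕ
  tape : M.T → ℕ → M.Γ
  head : M.T → ℕ
  out : List Bool

/-- The initial configuration. -/
def init : M.Cfg where
  state := M.start
  inputPos := 0
  tape := fun _ _ => M.blank
  head := fun _ => 0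
  out := []

/-- The effect of an action. The input head does not leave the cells `0, …, w.length + 1`. -/
noncomputable def perform (w : List Bool) (c : M.Cfg) (a : Action M.Q M.Γ M.T) : M.Cfg where
  state := a.next
  inputPos := min (w.length + 1) (a.inputMove.apply c.inputPos)
  tape := fun t => Function.update (c.tape t) (c.head t) (a.write t)
  head := fun t => (a.workMove t).apply (c.head t)
  out := c.out ++ a.output.toList

/-- One step of the machine on the input word `w`. -/
noncomputable def step (w : List Bool) (c : M.Cfg) : Option M.Cfg :=
  (M.δ c.state (readInput w c.inputPos) (fun t => c.tape t (c.head t))).map (M.perform w c)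

/-- The configurations that occur in the computation on `w`. -/
def Reached (w : List Bool) (c : M.Cfg) : Prop :=
  StateTransition.Reaches (M.step w) M.init c

/-- On input `w` the machine halts with output `w'`. -/
def Outputs (w w' : List Bool) : Prop :=
  ∃ c, M.Reached w c ∧ M.step w c = none ∧ c.out = w'

/-- On input `w` no work-tape head ever visits a cell outside `0, …, s - 1`. -/
def UsesSpace (w : List Bool) (s : ℕ) : Prop :=
  ∀ c, M.Reached w c → ∀ t, c.head t < s

end Machine

/-- `f` is computed, with respect to the given encodings, by a machine whose work space is
`O(log n)` on inputs of length `n`. -/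
def LogspaceComputable {α β : Type} (encα : α → List Bool) (encβ : β → List Bool)
    (f : α → β) : Prop :=
  ∃ (M : Machine) (C : ℕ), ∀ x,
    M.Outputs (encα x) (encβ (f x)) ∧
      M.UsesSpace (encα x) (C * (Nat.log 2 (encα x).length + 1))

/-! ### The decision problems -/

/-- A decision problem: instances, their encoding as binary words, and the yes-instances. -/
structure DecisionProblem where
  Instance : Type
  enc : Instance → List Bool
  Yes : Instance → Prop

/-- `f` is a logspace many-one reduction of `A` to `B`. -/
def IsLogspaceReduction (A B : DecisionProblem) (f : A.Instance → B.Instance) : Prop :=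
  LogspaceComputable A.enc B.enc f ∧ ∀ x, A.Yes x ↔ B.Yes (f x)

open Classical in
/-- The encoding of a digraph on `{0, …, n - 1}` and a number: `n` in unary, a separator, the
adjacency matrix row by row, and the number in unary. -/
noncomputable def encodeDigraph {n : ℕ} (G : Digraph (Fin n)) (K : ℕ) : List Bool :=
  List.replicate n true ++ [false] ++
    ((List.finRange n).flatMap fun v => (List.finRange n).map fun u => decide (G.Adj v u)) ++
    List.replicate K true

/-- Instances of Feedback Arc Set on the restricted class of digraphs. -/
structure FASInstance where
  n : ℕ
  G : Digraph (Fin n)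
  K : ℕ
  restricted : IsRestricted G
  one_le : 1 ≤ K
  le_card : K ≤ n

/-- Instances of Acyclic Hamiltonian Partition. -/
structure AHPInstance where
  n : ℕ
  G : Digraph (Fin n)
  K : ℕ
  acyclic : IsAcyclic G
  one_le : 1 ≤ K
  le_card : K ≤ n

/-- Feedback Arc Set, for digraphs without self-loops in which every vertex has in-degree or
out-degree equal to 1. -/
noncomputable def restrictedFAS : DecisionProblem where
  Instance := FASInstance
  enc x := encodeDigraph x.G x.K
  Yes x := HasFeedbackArcSet x.G x.K

/-- Acyclic Hamiltonian Partition. -/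
noncomputable def acyclicHamiltonianPartition : DecisionProblem where
  Instance := AHPInstance
  enc x := encodeDigraph x.G x.K
  Yes x := HasAcyclicHamiltonianPartition x.G x.K

end AHP

namespace AHP

universe u

open Relation

/-! ### Closed walks, cycles and ranks -/

section Digraphs

variable {V : Type u}

/-! Write m for |E|. A gadget is an (m+1)×(m+1) grid in which reachability is the componentwise
order, and nothing leaves it. The glue vertices are sources, and different gadgets are incomparable.
Two vertices of one class lie on a common path, so they are comparable. The antidiagonal vertices of
all gadgets are pairwise incomparable, so every partition has at least |V|(m+1) classes, and the
question is how many more are needed.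

Given a feedback arc set F, cut each gadget into its m+1 rows, put the glue vertex of each arc
outside F in front of the row of its tail that it points to, and leave the glue vertices of F alone.
The quotient is acyclic because G without F is (`hasHamiltonianPathOn_rowClass`,
`isAcyclic_rowClass`).

Conversely, let a partition with at most k + |V|(m+1) classes be given. Call a gadget tight if all
its classes meet its antidiagonal. Each glue vertex that is alone and each gadget that is not tight
accounts for a class beyond those of the antidiagonals, so together there are at most k of them. Let
F consist of the arcs of the lone glue vertices and, for each gadget that is not tight, one arc
through which all cycles at that vertex must pass; such an arc exists because the in-degree or the
out-degree is 1 (`IsRestricted.exists_arc`).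

F meets all cycles. Classes are convex since the quotient is acyclic (`IsClassMap.convex`), so in a
tight gadget the class of the corner (0,0) contains the whole first row or the whole first column
(`IsClassMap.row_or_column`). No glue vertex is in the class of a corner. A glue vertex that is not
alone belongs to the class of its neighbour at the tail or at the head; the former forces the row
alternative in the gadget of the tail, the latter the column alternative in that of the head. Hence
on a cycle that avoids F the same choice is made at all arcs, and the cycle, traversed forwards or
backwards, becomes a closed walk between different classes, which is impossible
(`IsClassMap.not_isDirectedCycle`).

For the space bound, m ≤ n² is less than the length of the input, so finitely many binary counters
bounded by that length suffice. Nested loops over such counters write the matrix of P(G, e) entry by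
entry, each entry being decided by comparing counters. Turing machines are assembled from routines
closed under sequence, branching and loops, and `exists_machine` and `encode_reductionDigraph` join
the two sides. -/

theorem exists_walk_of_transGen {r : V → V → Prop} {a b : V} (h : TransGen r a b) :
    ∃ (n : ℕ) (f : ℕ → V), f 0 = a ∧ f (n + 1) = b ∧ ∀ i ≤ n, r (f i) (f (i + 1)) := by
  induction h with
  | single h => exact ⟨0, fun i => if i = 0 then a else _, rfl, rfl, by simpa using h⟩
  | @tail c d _ h ih =>
    obtain ⟨n, f, h0, h1, h2⟩ := ih
    refine ⟨n + 1, fun i => if i ≤ n + 1 then f i else d, by simpa using h0, by simp, ?_⟩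
    intro i hi
    rcases Nat.lt_or_ge n i with hlt | hle
    · obtain rfl : i = n + 1 := by omega
      simpa [h1] using h
    · simpa [hi, hle] using h2 i hle

/-- A digraph with a closed walk has a directed cycle. -/
theorem exists_isDirectedCycle_of_transGen {G : Digraph V} {v : V} (h : TransGen G.Adj v v) :
    ∃ (m : ℕ) (c : Fin (m + 1) → V), IsDirectedCycle G c := by
  classical
  have hex : ∃ (n : ℕ) (f : ℕ → V), f 0 = f (n + 1) ∧ ∀ i ≤ n, G.Adj (f i) (f (i + 1)) := by
    obtain ⟨n, f, h0, h1, h2⟩ := exists_walk_of_transGen h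
    exact ⟨n, f, h0.trans h1.symm, h2⟩
  obtain ⟨f, hf, hadj⟩ := Nat.find_spec hex
  -- A shortest closed walk repeats no vertex: the segment between two equal positions would be a
  -- shorter closed walk.
  set n := Nat.find hex with hn
  have hne : ∀ i j, i < j → j ≤ n → f i ≠ f j := by
    intro i j hij hj he
    refine Nat.find_min hex (m := j - i - 1) (by omega) ⟨fun k => f (i + k), ?_, ?_⟩
    · simpa [show i + (j - i - 1 + 1) = j by omega] using he
    · intro k hk
      exact hadj (i + k) (by omega)
  refine ⟨n, fun i => f i, ?_, ?_⟩
  · intro i j hij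
    rcases lt_trichotomy i j with hlt | heq | hgt
    · exact absurd hij (hne _ _ hlt (by omega))
    · exact heq
    · exact absurd hij.symm (hne _ _ hgt (by omega))
  · intro i
    rcases eq_or_ne i (Fin.last n) with rfl | hi
    · have := hadj n le_rfl
      simpa [← hf] using this
    · have := hadj i (by omega)
      rwa [← Fin.val_add_one_of_lt (Fin.lt_last_iff_ne_last.2 hi)] at this

/-- A function that increases along all arcs shows that a digraph is acyclic. -/
theorem isAcyclic_of_rank {G : Digraph V} (r : V → ℕ) (h : ∀ a b, G.Adj a b → r a < r b) :
    IsAcyclic G := by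
  intro m c hc
  obtain ⟨i, hi⟩ := Finite.exists_max fun i => r (c i)
  exact absurd (hi (i + 1)) (not_le.2 (h _ _ (hc.2 i)))

theorem IsAcyclic.eq_of_reflTransGen {G : Digraph V} (hG : IsAcyclic G) {a b : V}
    (hab : ReflTransGen G.Adj a b) (hba : ReflTransGen G.Adj b a) : a = b := by
  by_contra hne
  have h : TransGen G.Adj a b := by
    rcases reflTransGen_iff_eq_or_transGen.1 hab with h | h
    · exact absurd h.symm hne
    · exact h
  obtain ⟨m, c, hc⟩ := exists_isDirectedCycle_of_transGen (h.trans_left hba)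
  exact hG m c hc

open Fin.CommRing in
/-- A property that is inherited by the cyclic successor holds everywhere or nowhere. -/
theorem forall_of_cyclic_succ {m : ℕ} {p : Fin (m + 1) → Prop} (h : ∀ i, p i → p (i + 1))
    {i : Fin (m + 1)} (hi : p i) (j : Fin (m + 1)) : p j := by
  have key : ∀ k : ℕ, p (i + (k : Fin (m + 1))) := by
    intro k
    induction k with
    | zero => simpa using hi
    | succ k ih =>
      have := h _ ih
      rwa [add_assoc, ← Nat.cast_succ] at this
  have := key (j - i : Fin (m + 1)).val
  rwa [Fin.cast_val_eq_self, add_sub_cancel] at this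

theorem reflTransGen_of_cyclic {α : Type*} {r : α → α → Prop} {m : ℕ} {f : Fin (m + 1) → α}
    (h : ∀ i, ReflTransGen r (f i) (f (i + 1))) (i j : Fin (m + 1)) :
    ReflTransGen r (f i) (f j) :=
  forall_of_cyclic_succ (p := fun j => ReflTransGen r (f i) (f j)) (fun k hk => hk.trans (h k))
    ReflTransGen.refl j

/-- Distinct vertices on a Hamiltonian path are comparable. -/
theorem HasHamiltonianPathOn.comparable {G : Digraph V} {P : Set V}
    (h : HasHamiltonianPathOn G P) {x y : V} (hx : x ∈ P) (hy : y ∈ P) (hne : x ≠ y) :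
    TransGen G.Adj x y ∨ TransGen G.Adj y x := by
  obtain ⟨l, -, hl, hc⟩ := h
  have hp : l.Pairwise (TransGen G.Adj) :=
    List.isChain_iff_pairwise.1 (hc.imp fun _ _ => TransGen.single)
  obtain ⟨i, hi, rfl⟩ := List.getElem_of_mem ((hl x).2 hx)
  obtain ⟨j, hj, rfl⟩ := List.getElem_of_mem ((hl y).2 hy)
  rcases lt_trichotomy i j with hlt | rfl | hgt
  · exact Or.inl (List.pairwise_iff_getElem.1 hp i j hi hj hlt)
  · exact absurd rfl hne
  · exact Or.inr (List.pairwise_iff_getElem.1 hp j i hj hi hgt)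

/-- The rank counts the ancestors of a vertex. Along an arc from a to b it grows strictly, since a
is an ancestor of b but not of itself. -/
theorem exists_rank_of_irrefl [Finite V] {r : V → V → Prop} (h : ∀ v, ¬ TransGen r v v) :
    ∃ ρ : V → ℕ, ∀ a b, r a b → ρ a < ρ b := by
  refine ⟨fun v => {w | TransGen r w v}.ncard, fun a b hab => ?_⟩
  refine Set.ncard_lt_ncard ⟨fun w hw => TransGen.tail hw hab, fun hs => ?_⟩
  exact h a (hs (TransGen.single hab))

/-! ### Reachability in `P(G, e)` -/

section Reachability

variable {G : Digraph V} {e : Arc G → ℕ}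

theorem isAcyclic_P (G : Digraph V) (e : Arc G → ℕ) : IsAcyclic (P G e) := by
  refine isAcyclic_of_rank
    (fun | .grid _ i j => i.val + j.val + 1 | .glue _ => 0) ?_
  rintro _ _ (⟨v, i, j, j', h⟩ | ⟨v, i, i', j, h⟩ | ⟨a, i, h⟩ | ⟨a, j, h⟩) <;> simp only <;> omega

/-- No arc leaves a gadget, and the arcs inside it only increase indices. With its converse
`reflTransGen_grid` this makes reachability from a grid vertex the componentwise order of the
gadget. -/
theorem exists_of_reflTransGen_grid {v : V} {i j : Fin (numArcs G + 1)} {y : PVertex G}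
    (h : ReflTransGen (P G e).Adj (.grid v i j) y) :
    ∃ i' j', y = .grid v i' j' ∧ i ≤ i' ∧ j ≤ j' := by
  induction h with
  | refl => exact ⟨i, j, rfl, le_rfl, le_rfl⟩
  | tail _ h ih =>
    obtain ⟨i', j', rfl, hi, hj⟩ := ih
    rcases h with ⟨_, _, _, j'', h⟩ | ⟨_, _, i'', _, h⟩
    · exact ⟨_, _, rfl, hi, hj.trans (by rw [Fin.le_def]; omega)⟩
    · exact ⟨_, _, rfl, hi.trans (by rw [Fin.le_def]; omega), hj⟩

theorem exists_of_transGen_glue {a : Arc G} {y : PVertex G}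
    (h : TransGen (P G e).Adj (.glue a) y) :
    ∃ i j, (y = .grid a.1.1 i j ∧ e a ≤ i) ∨ (y = .grid a.1.2 i j ∧ e a ≤ j) := by
  obtain ⟨z, hz, hzy⟩ := TransGen.head'_iff.1 h
  rcases hz with _ | _ | ⟨_, i, hia⟩ | ⟨_, j, hja⟩
  · obtain ⟨i', j', rfl, hi, hj⟩ := exists_of_reflTransGen_grid hzy
    exact ⟨i', j', Or.inl ⟨rfl, hia ▸ hi⟩⟩
  · obtain ⟨i', j', rfl, hi, hj⟩ := exists_of_reflTransGen_grid hzy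
    exact ⟨i', j', Or.inr ⟨rfl, hja ▸ hj⟩⟩

theorem reflTransGen_column (v : V) (j : Fin (numArcs G + 1)) {i i' : Fin (numArcs G + 1)}
    (h : i ≤ i') : ReflTransGen (P G e).Adj (.grid v i j) (.grid v i' j) := by
  obtain ⟨k, hk⟩ := Nat.exists_eq_add_of_le (Fin.le_def.1 h)
  induction k generalizing i' with
  | zero => rw [Fin.ext (a := i') (b := i) (by omega)]
  | succ k ih =>
    exact (ih (i' := ⟨i + k, by omega⟩) (by simp [Fin.le_def]) rfl).tail
      (.column _ _ _ _ (by simp; omega))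

theorem reflTransGen_row (v : V) (i : Fin (numArcs G + 1)) {j j' : Fin (numArcs G + 1)}
    (h : j ≤ j') : ReflTransGen (P G e).Adj (.grid v i j) (.grid v i j') := by
  obtain ⟨k, hk⟩ := Nat.exists_eq_add_of_le (Fin.le_def.1 h)
  induction k generalizing j' with
  | zero => rw [Fin.ext (a := j') (b := j) (by omega)]
  | succ k ih =>
    exact (ih (j' := ⟨j + k, by omega⟩) (by simp [Fin.le_def]) rfl).tail
      (.row _ _ _ _ (by simp; omega))

theorem reflTransGen_grid (v : V) {i j i' j' : Fin (numArcs G + 1)} (hi : i ≤ i') (hj : j ≤ j') :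
    ReflTransGen (P G e).Adj (.grid v i j) (.grid v i' j') :=
  (reflTransGen_column v j hi).trans (reflTransGen_row v i' hj)

theorem not_adj_glue (x : PVertex G) (a : Arc G) : ¬ (P G e).Adj x (.glue a) := nofun

end Reachability

/-! ### From feedback arc sets to partitions -/

section ToPartition

variable {G : Digraph V} {e : Arc G → ℕ}

theorem fiber_mem_unique {α β : Type*} {κ : α → β} {s : Set α}
    (hs : s ∈ Set.range fun y => κ ⁻¹' {y}) {x : α} (hx : x ∈ s) : s = κ ⁻¹' {κ x} := by
  obtain ⟨y, rfl⟩ := hs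
  rw [Set.mem_preimage, Set.mem_singleton_iff] at hx
  rw [hx]

theorem isPartition_fibers {α β : Type*} {κ : α → β} (hκ : Function.Surjective κ) :
    Setoid.IsPartition (Set.range fun y => κ ⁻¹' {y}) := by
  constructor
  · rintro ⟨y, hy⟩
    obtain ⟨x, rfl⟩ := hκ y
    exact (hy ▸ (show x ∈ κ ⁻¹' {κ x} from rfl) : x ∈ (∅ : Set α))
  · intro x
    exact ⟨κ ⁻¹' {κ x}, ⟨⟨_, rfl⟩, rfl⟩, fun s hs => fiber_mem_unique hs.1 hs.2⟩

open Classical in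
/-- The gadgets are cut into rows; the glue vertex of an arc outside `F` joins a row of the gadget
of its tail, and that of an arc in `F` is left alone. -/
noncomputable def rowClass {F : Set (V × V)} (he : IsArcNumbering G e) :
    PVertex G → (V × Fin (numArcs G + 1)) ⊕ F
  | .grid v i _ => .inl (v, i)
  | .glue a => if h : a.1 ∈ F then .inr ⟨a.1, h⟩
      else .inl (a.1.1, ⟨e a, Nat.lt_succ_of_le (he.2 a).2⟩)

theorem rowClass_surjective {F : Set (V × V)} (he : IsArcNumbering G e)
    (hF : ∀ a ∈ F, G.Adj a.1 a.2) : Function.Surjective (rowClass (F := F) he) := by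
  rintro (⟨v, i⟩ | ⟨a, ha⟩)
  · exact ⟨.grid v i 0, rfl⟩
  · exact ⟨.glue ⟨a, hF a ha⟩, by simp [rowClass, ha]⟩

theorem isChain_finRange (n : ℕ) :
    (List.finRange n).IsChain (fun i j : Fin n => (j : ℕ) = i + 1) := by
  simp [List.isChain_iff_getElem]

/-- A row is a path that starts in column 0. Because the numbering is injective, at most one glue
vertex joins the row, and its arc to column 0 prolongs the path at the front. -/
theorem hasHamiltonianPathOn_rowClass {F : Set (V × V)} (he : IsArcNumbering G e)
    (hF : ∀ a ∈ F, G.Adj a.1 a.2) (y : (V × Fin (numArcs G + 1)) ⊕ F) :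
    HasHamiltonianPathOn (P G e) (rowClass he ⁻¹' {y}) := by
  classical
  rcases y with ⟨v, i⟩ | ⟨a, ha⟩
  · have hrow : ((List.finRange (numArcs G + 1)).map (PVertex.grid (G := G) v i)).IsChain
        (P G e).Adj :=
      (List.isChain_map _).2 ((isChain_finRange _).imp fun j j' h => .row v i j j' h)
    have hnd : ((List.finRange (numArcs G + 1)).map (PVertex.grid (G := G) v i)).Nodup :=
      (List.nodup_finRange _).map fun j j' h => by simpa using h
    by_cases h : ∃ a : Arc G, a.1 ∉ F ∧ a.1.1 = v ∧ e a = i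
    · obtain ⟨a, haF, rfl, hai⟩ := h
      refine ⟨.glue a :: (List.finRange (numArcs G + 1)).map (PVertex.grid a.1.1 i), ?_, ?_, ?_⟩
      · exact List.nodup_cons.2 ⟨by simp, hnd⟩
      · rintro (⟨w, i', j⟩ | ⟨b⟩)
        · simp [rowClass, eq_comm]
        · by_cases hb : b.1 ∈ F
          · simp only [List.mem_cons, PVertex.glue.injEq, List.mem_map, reduceCtorEq, and_false,
              exists_false, or_false, Set.mem_preimage, rowClass, hb, dite_true,
              Set.mem_singleton_iff, iff_false]
            rintro rfl
            exact haF hb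
          · simp only [List.mem_cons, PVertex.glue.injEq, List.mem_map, reduceCtorEq, and_false,
              exists_false, or_false, Set.mem_preimage, rowClass, hb, dite_false,
              Set.mem_singleton_iff, Sum.inl.injEq, Prod.mk.injEq, Fin.ext_iff]
            constructor
            · rintro rfl
              exact ⟨rfl, hai⟩
            · rintro ⟨-, h⟩
              exact he.1 (h.trans hai.symm)
      · rw [List.finRange_succ, List.map_cons] at hrow ⊢
        exact List.isChain_cons_cons.2 ⟨.toTail a i hai.symm, hrow⟩
    · refine ⟨(List.finRange (numArcs G + 1)).map (PVertex.grid v i), hnd, ?_, hrow⟩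
      rintro (⟨w, i', j⟩ | ⟨b⟩)
      · simp [rowClass, eq_comm]
      · by_cases hb : b.1 ∈ F
        · simp [rowClass, hb]
        · simp only [List.mem_map, reduceCtorEq, and_false, exists_false, Set.mem_preimage,
            rowClass, hb, dite_false, Set.mem_singleton_iff, Sum.inl.injEq, Prod.mk.injEq,
            Fin.ext_iff, false_iff]
          rintro ⟨h1, h2⟩
          exact h ⟨b, hb, h1, h2⟩
  · refine ⟨[.glue ⟨a, hF a ha⟩], by simp, ?_, by simp⟩
    rintro (⟨w, i', j⟩ | ⟨b⟩)
    · simp [rowClass]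
    · by_cases hb : b.1 ∈ F
      · simp [rowClass, hb, Subtype.ext_iff]
      · simp only [List.mem_singleton, PVertex.glue.injEq, Set.mem_preimage, rowClass, hb,
          dite_false, Set.mem_singleton_iff, reduceCtorEq, iff_false]
        rintro rfl
        exact hb ha

theorem isAcyclic_rowClass [Finite V] {F : Set (V × V)} (he : IsArcNumbering G e)
    (hF : IsFeedbackArcSet G F) :
    IsAcyclic (quotientDigraph (P G e)
      (Set.range fun y : (V × Fin (numArcs G + 1)) ⊕ F => rowClass he ⁻¹' {y})) := by
  classical
  -- A closed walk in G without F would contain a cycle that F misses.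
  obtain ⟨ρ, hρ⟩ := exists_rank_of_irrefl (r := fun a b => G.Adj a b ∧ (a, b) ∉ F) <| by
    intro v hv
    obtain ⟨m, c, hc⟩ := exists_isDirectedCycle_of_transGen
      (G := ⟨fun a b => G.Adj a b ∧ (a, b) ∉ F⟩) hv
    obtain ⟨i, hi⟩ := hF.2 m c ⟨hc.1, fun i => (hc.2 i).1⟩
    exact (hc.2 i).2 hi
  -- Lexicographic order by gadget and row: the factor is the number of rows of a gadget, so a
  -- larger ρ outweighs any row index. The summand 1 reserves rank 0 for the lone glue vertices,
  -- which are sources.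
  let r : (V × Fin (numArcs G + 1)) ⊕ F → ℕ := Sum.elim
    (fun p => 1 + ρ p.1 * (numArcs G + 1) + p.2) (fun _ => 0)
  choose y hy using fun s : Set.range fun y : (V × Fin (numArcs G + 1)) ⊕ F =>
    rowClass he ⁻¹' {y} => s.2
  refine isAcyclic_of_rank (fun s => r (y s)) ?_
  rintro s t ⟨hne, x, hx, z, hz, hadj⟩
  have hs : rowClass he x = y s := by
    rw [← hy s] at hx
    exact hx
  have ht : rowClass he z = y t := by
    rw [← hy t] at hz
    exact hz
  have hst : y s ≠ y t := fun h => hne (Subtype.ext (by rw [← hy s, ← hy t, h]))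
  rw [← hs, ← ht] at hst ⊢
  rcases hadj with ⟨v, i, j, j', h⟩ | ⟨v, i, i', j, h⟩ | ⟨a, i, h⟩ | ⟨a, j, h⟩
  · exact absurd rfl hst
  · simp only [rowClass, Sum.elim_inl, r]
    omega
  · by_cases ha : a.1 ∈ F
    · simp only [rowClass, ha, dite_true, Sum.elim_inl, Sum.elim_inr, r]
      omega
    · refine absurd ?_ hst
      simp [rowClass, ha, Fin.ext_iff, h]
  · by_cases ha : a.1 ∈ F
    · simp only [rowClass, ha, dite_true, Sum.elim_inl, Sum.elim_inr, r]
      omega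
    · have h1 := hρ a.1.1 a.1.2 ⟨a.2, ha⟩
      have h2 := Nat.mul_le_mul_right (numArcs G + 1) (Nat.succ_le_of_lt h1)
      have h3 := (he.2 a).2
      simp only [rowClass, ha, dite_false, Sum.elim_inl, r, Nat.succ_mul, Fin.val_zero] at h2 ⊢
      omega

theorem HasFeedbackArcSet.hasAcyclicHamiltonianPartition [Finite V] (he : IsArcNumbering G e)
    {k : ℕ} (h : HasFeedbackArcSet G k) :
    HasAcyclicHamiltonianPartition (P G e) (k + Nat.card V * (numArcs G + 1)) := by
  obtain ⟨F, hF, hcard⟩ := h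
  refine ⟨Set.range fun y : (V × Fin (numArcs G + 1)) ⊕ F => rowClass he ⁻¹' {y},
    ⟨isPartition_fibers (rowClass_surjective he hF.1), ?_, isAcyclic_rowClass he hF⟩, ?_⟩
  · rintro _ ⟨y, rfl⟩
    exact hasHamiltonianPathOn_rowClass he hF.1 y
  · calc (Set.range fun y : (V × Fin (numArcs G + 1)) ⊕ F => rowClass he ⁻¹' {y}).encard
        ≤ ENat.card ((V × Fin (numArcs G + 1)) ⊕ F) := by
          rw [← Set.image_univ, ← Set.encard_univ]
          exact Set.encard_image_le _ _
      _ = Nat.card V * (numArcs G + 1) + F.encard := by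
          rw [ENat.card_sum, ENat.card_prod]
          simp [ENat.card_eq_coe_natCard V]
      _ ≤ _ := by
          push_cast
          rw [add_comm]
          gcongr

end ToPartition

/-! ### From partitions to feedback arc sets -/

section FromPartition

variable {G : Digraph V} {e : Arc G → ℕ}

/-- `cls` sends each vertex to its class in an acyclic Hamiltonian partition. -/
structure IsClassMap {W : Type u} (H : Digraph W) (π : Set (Set W)) (cls : W → π) : Prop where
  comparable : ∀ x y, cls x = cls y → x ≠ y → TransGen H.Adj x y ∨ TransGen H.Adj y x
  mono : ∀ x y, ReflTransGen H.Adj x y → ReflTransGen (quotientDigraph H π).Adj (cls x) (cls y)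
  acyclic : IsAcyclic (quotientDigraph H π)

/-- An arc inside a class collapses to a point of the quotient and any other arc maps to an arc, so
paths map to paths. -/
theorem IsAcyclicHamiltonianPartition.exists_isClassMap {W : Type u} {H : Digraph W}
    {π : Set (Set W)} (h : IsAcyclicHamiltonianPartition H π) :
    ∃ cls : W → π, IsClassMap H π cls := by
  obtain ⟨hpart, hham, hac⟩ := h
  choose c hc huniq using hpart.2
  refine ⟨fun x => ⟨c x, (hc x).1⟩, ?_, ?_, hac⟩
  · intro x y hxy hne
    have hxy : c x = c y := congrArg Subtype.val hxy
    exact (hham _ (hc x).1).comparable (hc x).2 (hxy ▸ (hc y).2) hne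
  · intro x y hxy
    refine ReflTransGen.lift' (fun x => (⟨c x, (hc x).1⟩ : π)) (fun a b hab => ?_) _ _ hxy
    rw [Function.onFun]
    by_cases hne : c a = c b
    · rw [show (⟨c a, (hc a).1⟩ : π) = ⟨c b, (hc b).1⟩ from Subtype.ext hne]
    · exact ReflTransGen.single
        ⟨fun h => hne (congrArg Subtype.val h), a, (hc a).2, b, (hc b).2, hab⟩

/-- A path that left a class and came back would give a closed walk in the quotient. -/
theorem IsClassMap.convex {W : Type u} {H : Digraph W} {π : Set (Set W)} {cls : W → π}
    (h : IsClassMap H π cls) {x y z : W} (hxy : ReflTransGen H.Adj x y)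
    (hyz : ReflTransGen H.Adj y z) (hxz : cls x = cls z) : cls x = cls y :=
  h.acyclic.eq_of_reflTransGen (h.mono _ _ hxy) (hxz ▸ h.mono _ _ hyz)

variable {π : Set (Set (PVertex G))} {cls : PVertex G → π}

theorem IsClassMap.grid_comparable (h : IsClassMap (P G e) π cls) {v u : V}
    {i j i' j' : Fin (numArcs G + 1)} (hc : cls (.grid v i j) = cls (.grid u i' j')) :
    v = u ∧ ((i ≤ i' ∧ j ≤ j') ∨ (i' ≤ i ∧ j' ≤ j)) := by
  by_cases hne : PVertex.grid v i j = .grid u i' j'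
  · cases hne
    exact ⟨rfl, Or.inl ⟨le_rfl, le_rfl⟩⟩
  · rcases h.comparable _ _ hc hne with h | h
    · obtain ⟨_, _, heq, hi, hj⟩ := exists_of_reflTransGen_grid h.to_reflTransGen
      cases heq
      exact ⟨rfl, Or.inl ⟨hi, hj⟩⟩
    · obtain ⟨_, _, heq, hi, hj⟩ := exists_of_reflTransGen_grid h.to_reflTransGen
      cases heq
      exact ⟨rfl, Or.inr ⟨hi, hj⟩⟩

/-- Along the antidiagonal one index grows as the other falls, so different antidiagonal vertices
are incomparable. This supplies the |V|(|E|+1) classes that every partition must have. -/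
theorem IsClassMap.antidiagonal_injective (h : IsClassMap (P G e) π cls) {v u : V}
    {i i' : Fin (numArcs G + 1)} (hc : cls (.grid v i i.rev) = cls (.grid u i' i'.rev)) :
    v = u ∧ i = i' := by
  obtain ⟨rfl, ⟨h1, h2⟩ | ⟨h1, h2⟩⟩ := h.grid_comparable hc
  · exact ⟨rfl, le_antisymm h1 (Fin.rev_le_rev.1 h2)⟩
  · exact ⟨rfl, le_antisymm (Fin.rev_le_rev.1 h2) h1⟩

/-- A glue vertex is a source, so comparability leaves only one direction. -/
theorem IsClassMap.transGen_of_glue (h : IsClassMap (P G e) π cls) {a : Arc G} {y : PVertex G}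
    (hc : cls (.glue a) = cls y) (hne : y ≠ .glue a) : TransGen (P G e).Adj (.glue a) y := by
  rcases h.comparable _ _ hc hne.symm with h | h
  · exact h
  · obtain ⟨z, -, hz⟩ := TransGen.tail'_iff.1 h
    exact absurd hz (not_adj_glue z a)

/-- A glue vertex reaches only grid vertices with a row or column index at least `e a`. That the
numbering starts at 1 keeps the corner out of reach. -/
theorem IsClassMap.glue_ne_corner (h : IsClassMap (P G e) π cls) (he : IsArcNumbering G e)
    (a : Arc G) (v : V) : cls (.glue a) ≠ cls (.grid v 0 0) := by
  intro hc
  have h1 := (he.2 a).1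
  obtain ⟨i, j, ⟨heq, hle⟩ | ⟨heq, hle⟩⟩ := exists_of_transGen_glue (h.transGen_of_glue hc nofun)
  · cases heq
    simp at hle
    omega
  · cases heq
    simp at hle
    omega

/-- A gadget is tight if each class that meets it meets its antidiagonal. -/
def Tight (cls : PVertex G → π) (v : V) : Prop :=
  ∀ i j, ∃ k : Fin (numArcs G + 1), cls (.grid v i j) = cls (.grid v k k.rev)

/-- In a tight gadget the first row or the first column lies in one class. -/
theorem IsClassMap.row_or_column (h : IsClassMap (P G e) π cls) {v : V} (ht : Tight cls v) :
    (∀ j, cls (.grid v 0 0) = cls (.grid v 0 j)) ∨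
      ∀ i, cls (.grid v 0 0) = cls (.grid v i 0) := by
  obtain ⟨k, hk⟩ := ht 0 0
  have h1 : cls (.grid v 0 0) = cls (.grid v k 0) :=
    h.convex (reflTransGen_grid v (Fin.zero_le _) le_rfl)
      (reflTransGen_grid v le_rfl (Fin.zero_le _)) hk
  have h2 : cls (.grid v 0 0) = cls (.grid v 0 k.rev) :=
    h.convex (reflTransGen_grid v le_rfl (Fin.zero_le _))
      (reflTransGen_grid v (Fin.zero_le _) le_rfl) hk
  -- The class of the corner contains (k, 0) and (0, m - k), which are comparable only if k = 0 or k
  -- = m. The antidiagonal vertex is then the end of the first row or of the first column.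
  rcases (h.grid_comparable (h1.symm.trans h2)).2 with ⟨hk0, -⟩ | ⟨-, hk0⟩
  · obtain rfl : k = 0 := Fin.le_zero_iff.1 hk0
    refine Or.inl fun j => h.convex (reflTransGen_row v 0 (Fin.zero_le _))
      (reflTransGen_row v 0 ?_) hk
    rw [Fin.rev_zero]
    exact Fin.le_last j
  · have hk0 : k.rev = 0 := Fin.le_zero_iff.1 hk0
    rw [hk0] at hk
    refine Or.inr fun i => h.convex (reflTransGen_column v 0 (Fin.zero_le _))
      (reflTransGen_column v 0 ?_) hk
    rw [← Fin.rev_rev k, hk0, Fin.rev_zero]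
    exact Fin.le_last i

/-- The glue vertex of `a` is in the class of its neighbour in the gadget of the tail. -/
def AtTail (cls : PVertex G → π) (he : IsArcNumbering G e) (a : Arc G) : Prop :=
  cls (.glue a) = cls (.grid a.1.1 ⟨e a, Nat.lt_succ_of_le (he.2 a).2⟩ 0)

/-- The glue vertex of `a` is in the class of its neighbour in the gadget of the head. -/
def AtHead (cls : PVertex G → π) (he : IsArcNumbering G e) (a : Arc G) : Prop :=
  cls (.glue a) = cls (.grid a.1.2 0 ⟨e a, Nat.lt_succ_of_le (he.2 a).2⟩)

/-- A path from the glue vertex to another vertex of its class begins at one of its two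
out-neighbours, and by convexity that neighbour is in the class. -/
theorem IsClassMap.atTail_or_atHead (h : IsClassMap (P G e) π cls) (he : IsArcNumbering G e)
    {a : Arc G} {y : PVertex G} (hc : cls (.glue a) = cls y) (hne : y ≠ .glue a) :
    AtTail cls he a ∨ AtHead cls he a := by
  obtain ⟨z, hz, hzy⟩ := TransGen.head'_iff.1 (h.transGen_of_glue hc hne)
  have hcz := h.convex (ReflTransGen.single hz) hzy hc
  rcases hz with _ | _ | ⟨_, i, hi⟩ | ⟨_, j, hj⟩
  · refine Or.inl (hcz.trans ?_)
    rw [Fin.ext (a := i) (b := ⟨e a, Nat.lt_succ_of_le (he.2 a).2⟩) hi]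
  · refine Or.inr (hcz.trans ?_)
    rw [Fin.ext (a := j) (b := ⟨e a, Nat.lt_succ_of_le (he.2 a).2⟩) hj]

/-- The column alternative of `row_or_column` would put the corner into the class of the glue
vertex. -/
theorem IsClassMap.row_of_atTail (h : IsClassMap (P G e) π cls) (he : IsArcNumbering G e)
    {a : Arc G} (ht : Tight cls a.1.1) (ha : AtTail cls he a) (j : Fin (numArcs G + 1)) :
    cls (.grid a.1.1 0 0) = cls (.grid a.1.1 0 j) := by
  rcases h.row_or_column ht with hr | hc
  · exact hr j
  · exact absurd (ha.trans (hc _).symm) (h.glue_ne_corner he a _)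

theorem IsClassMap.column_of_atHead (h : IsClassMap (P G e) π cls) (he : IsArcNumbering G e)
    {a : Arc G} (ht : Tight cls a.1.2) (ha : AtHead cls he a) (i : Fin (numArcs G + 1)) :
    cls (.grid a.1.2 0 0) = cls (.grid a.1.2 i 0) := by
  rcases h.row_or_column ht with hr | hc
  · exact absurd (ha.trans (hr _).symm) (h.glue_ne_corner he a _)
  · exact hc i

/-- No directed cycle runs through tight gadgets only and arcs whose glue vertices are not alone. -/
theorem IsClassMap.not_isDirectedCycle (h : IsClassMap (P G e) π cls) (he : IsArcNumbering G e)
    (hloop : ∀ v, ¬ G.Adj v v) {m : ℕ} {c : Fin (m + 1) → V} (hcyc : ∀ i, G.Adj (c i) (c (i + 1)))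
    (ht : ∀ i, Tight cls (c i))
    (ha : ∀ i, ∃ y, y ≠ .glue ⟨(c i, c (i + 1)), hcyc i⟩ ∧
      cls (.glue ⟨(c i, c (i + 1)), hcyc i⟩) = cls y) : False := by
  let a : Fin (m + 1) → Arc G := fun i => ⟨(c i, c (i + 1)), hcyc i⟩
  have hglue : ∀ i, AtTail cls he (a i) ∨ AtHead cls he (a i) := by
    intro i
    obtain ⟨y, hy, hcy⟩ := ha i
    exact h.atTail_or_atHead he hcy hy
  -- The first condition puts the whole first column of the common gadget into the class of the
  -- corner, and the second would put a glue vertex there too.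
  have hexcl : ∀ i, AtHead cls he (a i) → ¬ AtTail cls he (a (i + 1)) := fun i h1 h2 =>
    h.glue_ne_corner he _ _
      (h2.trans (h.column_of_atHead he (a := a i) (ht _) h1 _).symm)
  have hne : c 0 ≠ c (0 + 1) := fun heq => hloop (c 0) (by
    have := hcyc 0
    rwa [← heq] at this)
  by_cases hex : ∃ i, AtHead cls he (a i)
  · obtain ⟨i, hi⟩ := hex
    have hall : ∀ i, AtHead cls he (a i) := forall_of_cyclic_succ
      (fun i hi => (hglue (i + 1)).resolve_left (hexcl i hi)) hi
    -- With all glue vertices at the heads, the walk in the quotient runs against the cycle: from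
    -- the glue vertex of the next arc to the first column of the common gadget, hence to the class
    -- of its corner, and on along the first row to the class of the glue vertex of the present arc.
    have hstep : ∀ i, ReflTransGen (Function.swap (quotientDigraph (P G e) π).Adj)
        (cls (.glue (a i))) (cls (.glue (a (i + 1)))) := by
      intro i
      refine reflTransGen_swap.2 (ReflTransGen.trans (h.mono _
        (.grid (c (i + 1)) ⟨e (a (i + 1)), Nat.lt_succ_of_le (he.2 _).2⟩ 0)
        (ReflTransGen.single (.toTail (a (i + 1)) _ rfl))) ?_)
      rw [← h.column_of_atHead he (a := a i) (ht _) (hall i)]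
      rw [hall i]
      exact h.mono _ _ (reflTransGen_grid _ (Fin.zero_le _) (Fin.zero_le _))
    -- The walk closes up, so its classes coincide, and one class meets the gadgets of two adjacent
    -- vertices. These are different, as there are no loops.
    have heq := h.acyclic.eq_of_reflTransGen
      (reflTransGen_swap.1 (reflTransGen_of_cyclic hstep 0 (0 + 1)))
      (reflTransGen_swap.1 (reflTransGen_of_cyclic hstep (0 + 1) 0))
    have h1 := hall 0
    have h2 := hall (0 + 1)
    have h3 := (h.grid_comparable (h1.symm.trans (heq.symm.trans h2))).1
    exact hloop (c (0 + 1)) (by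
      have := hcyc (0 + 1)
      rwa [show c (0 + 1 + 1) = c (0 + 1) from h3.symm] at this)
  · have hall : ∀ i, AtTail cls he (a i) := fun i =>
      (hglue i).resolve_right fun hi => hex ⟨i, hi⟩
    -- The mirror image, along the cycle: into the first row of the next gadget, hence to its
    -- corner's class, and down the first column to the next glue vertex's class.
    have hstep : ∀ i, ReflTransGen (quotientDigraph (P G e) π).Adj
        (cls (.glue (a i))) (cls (.glue (a (i + 1)))) := by
      intro i
      refine ReflTransGen.trans (h.mono _
        (.grid (c (i + 1)) 0 ⟨e (a i), Nat.lt_succ_of_le (he.2 _).2⟩)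
        (ReflTransGen.single (.toHead (a i) _ rfl))) ?_
      rw [← h.row_of_atTail he (a := a (i + 1)) (ht _) (hall (i + 1)), hall (i + 1)]
      exact h.mono _ _ (reflTransGen_grid _ (Fin.zero_le _) (Fin.zero_le _))
    have heq := h.acyclic.eq_of_reflTransGen
      (reflTransGen_of_cyclic hstep 0 (0 + 1)) (reflTransGen_of_cyclic hstep (0 + 1) 0)
    exact hne (h.grid_comparable ((hall 0).symm.trans (heq.trans (hall (0 + 1))))).1

/-- Each vertex of a restricted digraph has an arc that lies on all cycles through the vertex. -/
theorem IsRestricted.exists_arc (hG : IsRestricted G) (v : V) :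
    ∃ s : V × V, G.Adj s.1 s.2 ∧ ∀ (m : ℕ) (c : Fin (m + 1) → V), IsDirectedCycle G c →
      ∀ i, c i = v → ∃ j, (c j, c (j + 1)) = s := by
  rcases hG.2 v with h | h
  · obtain ⟨u, hu⟩ := Set.encard_eq_one.1 h
    have huv : ∀ x, G.Adj x v ↔ x = u := fun x => by
      rw [← Set.mem_singleton_iff, ← hu, Set.mem_ofPred_eq]
    refine ⟨(u, v), (huv u).2 rfl, fun m c hc i hi => ⟨i - 1, ?_⟩⟩
    have := hc.2 (i - 1)
    rw [sub_add_cancel, hi] at this ⊢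
    rw [(huv _).1 this]
  · obtain ⟨u, hu⟩ := Set.encard_eq_one.1 h
    have huv : ∀ x, G.Adj v x ↔ x = u := fun x => by
      rw [← Set.mem_singleton_iff, ← hu, Set.mem_ofPred_eq]
    refine ⟨(v, u), (huv u).2 rfl, fun m c hc i hi => ⟨i, ?_⟩⟩
    have := hc.2 i
    rw [hi] at this ⊢
    rw [(huv _).1 this]

theorem HasAcyclicHamiltonianPartition.hasFeedbackArcSet [Finite V] (hG : IsRestricted G)
    (he : IsArcNumbering G e) {k : ℕ}
    (h : HasAcyclicHamiltonianPartition (P G e) (k + Nat.card V * (numArcs G + 1))) :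
    HasFeedbackArcSet G k := by
  obtain ⟨π, hπ, hcard⟩ := h
  obtain ⟨cls, h⟩ := hπ.exists_isClassMap
  choose s hs hcs using hG.exists_arc
  let S := {a : Arc G // ∀ y, cls (.glue a) = cls y → y = .glue a}
  let B := {v : V // ¬ Tight cls v}
  have hB : ∀ v : B, ∃ i j, ∀ k, cls (.grid v.1 i j) ≠ cls (.grid v.1 k k.rev) := by
    intro v
    have := v.2
    unfold Tight at this
    push Not at this
    exact this
  choose bi bj hb using hB
  refine ⟨Set.range (Sum.elim (fun a : S => a.1.1) (fun v : B => s v.1)), ⟨?_, ?_⟩, ?_⟩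
  · rintro _ ⟨a | v, rfl⟩
    · exact a.1.2
    · exact hs v.1
  · intro m c hc
    by_contra! hno
    refine h.not_isDirectedCycle he hG.1 hc.2 (fun i => ?_) (fun i => ?_)
    · by_contra ht
      obtain ⟨j, hj⟩ := hcs (c i) m c hc i rfl
      exact hno j ⟨.inr ⟨c i, ht⟩, hj.symm⟩
    · by_contra! hy
      exact hno i ⟨.inl ⟨⟨_, hc.2 i⟩, fun y hy' => by
        by_contra hne
        exact hy y hne hy'⟩, rfl⟩
  · have hinj : Function.Injective (Sum.elim
        (fun p : V × Fin (numArcs G + 1) => cls (.grid p.1 p.2 p.2.rev))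
        (Sum.elim (fun a : S => cls (.glue a.1)) (fun v : B => cls (.grid v.1 (bi v) (bj v))))) := by
      refine Function.Injective.sumElim ?_ (Function.Injective.sumElim ?_ ?_ ?_) ?_
      · rintro ⟨v, i⟩ ⟨u, j⟩ hij
        obtain ⟨rfl, rfl⟩ := h.antidiagonal_injective hij
        rfl
      · intro a b hab
        have := a.2 _ hab
        exact Subtype.ext (PVertex.glue.inj this).symm
      · intro v w hvw
        exact Subtype.ext (h.grid_comparable hvw).1
      · intro a v hav
        exact absurd (a.2 _ hav) nofun
      · rintro ⟨v, i⟩ (a | w) hc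
        · exact absurd (a.2 _ hc.symm) nofun
        · obtain rfl := (h.grid_comparable hc).1
          exact hb w i hc.symm
    have hle : ENat.card ((V × Fin (numArcs G + 1)) ⊕ (S ⊕ B)) ≤
        ((k + Nat.card V * (numArcs G + 1) : ℕ) : ℕ∞) :=
      (ENat.card_le_card_of_injective hinj).trans hcard
    -- Cancelling the |V|(|E|+1) antidiagonal classes needs finite cardinals, so the inequality
    -- moves from `ℕ∞` to `ℕ`.
    rw [ENat.card_sum, ENat.card_prod, ENat.card_eq_coe_natCard V,
      ENat.card_eq_coe_natCard (Fin _), Nat.card_fin, ENat.card_eq_coe_natCard (S ⊕ B)] at hle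
    have hle' : Nat.card (S ⊕ B) ≤ k := by
      norm_cast at hle
      omega
    calc (Set.range (Sum.elim (fun a : S => a.1.1) (fun v : B => s v.1))).encard
        ≤ ENat.card (S ⊕ B) := by
          rw [← Set.image_univ, ← Set.encard_univ]
          exact Set.encard_image_le _ _
      _ ≤ k := by
          rw [ENat.card_eq_coe_natCard]
          exact_mod_cast hle'

end FromPartition

/-- Feedback arc sets of `G` correspond to acyclic Hamiltonian partitions of `P(G, e)`. -/
theorem hasFeedbackArcSet_iff [Finite V] {G : Digraph V} (hG : IsRestricted G) {e : Arc G → ℕ}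
    (he : IsArcNumbering G e) (k : ℕ) :
    HasFeedbackArcSet G k ↔
      HasAcyclicHamiltonianPartition (P G e) (k + Nat.card V * (numArcs G + 1)) :=
  ⟨fun h => h.hasAcyclicHamiltonianPartition he, fun h => h.hasFeedbackArcSet hG he⟩

/-! ### Invariance of partitions under isomorphism -/

theorem quotientDigraph_adj_image {W : Type u} {H : Digraph V} {H' : Digraph W}
    (φ : H.Adj ≃r H'.Adj) {π : Set (Set V)} {s t : π}
    (h : (quotientDigraph H' (Set.image φ '' π)).Adj ⟨φ '' s.1, s.1, s.2, rfl⟩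
      ⟨φ '' t.1, t.1, t.2, rfl⟩) : (quotientDigraph H π).Adj s t := by
  obtain ⟨hne, _, ⟨x, hx, rfl⟩, _, ⟨y, hy, rfl⟩, hxy⟩ := h
  exact ⟨fun h => hne (by rw [h]), x, hx, y, hy, φ.map_rel_iff.1 hxy⟩

theorem HasAcyclicHamiltonianPartition.of_relIso {W : Type u} {H : Digraph V} {H' : Digraph W}
    (φ : H.Adj ≃r H'.Adj) {K : ℕ} (h : HasAcyclicHamiltonianPartition H K) :
    HasAcyclicHamiltonianPartition H' K := by
  obtain ⟨π, ⟨hpart, hham, hac⟩, hcard⟩ := h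
  refine ⟨Set.image φ '' π, ⟨⟨?_, ?_⟩, ?_, ?_⟩, (Set.encard_image_le _ _).trans hcard⟩
  · rintro ⟨s, hs, he⟩
    rw [Set.image_eq_empty] at he
    exact hpart.1 (he ▸ hs)
  · intro y
    obtain ⟨s, ⟨hs, hys⟩, huniq⟩ := hpart.2 (φ.symm y)
    refine ⟨φ '' s, ⟨⟨s, hs, rfl⟩, ⟨_, hys, φ.apply_symm_apply y⟩⟩, ?_⟩
    rintro _ ⟨⟨t, ht, rfl⟩, ⟨x, hx, rfl⟩⟩
    rw [huniq t ⟨ht, by simpa using hx⟩]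
  · rintro _ ⟨s, hs, rfl⟩
    obtain ⟨l, hnd, hl, hc⟩ := hham s hs
    refine ⟨l.map φ, hnd.map φ.injective, fun y => ?_, ?_⟩
    · simp [hl]
    · exact (List.isChain_map _).2 (hc.imp fun a b hab => φ.map_rel_iff.2 hab)
  · intro m c hc
    choose t ht htc using fun i => (c i).2
    refine hac m (fun i => ⟨t i, ht i⟩) ⟨fun i j hij => hc.1 (Subtype.ext ?_), fun i => ?_⟩
    · rw [← htc i, ← htc j, show t i = t j from congrArg Subtype.val hij]
    · refine quotientDigraph_adj_image φ ?_
      have h := hc.2 i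
      rwa [show c i = ⟨φ '' t i, t i, ht i, rfl⟩ from Subtype.ext (htc i).symm,
        show c (i + 1) = ⟨φ '' t (i + 1), t (i + 1), ht (i + 1), rfl⟩ from
          Subtype.ext (htc (i + 1)).symm] at h

end Digraphs

/-! ### Routines: composable pieces of Turing machines -/

/-- The part of a configuration that different machines can share. -/
@[ext]
structure Data (Γ T : Type) where
  inputPos : ℕ
  tape : T → ℕ → Γ
  head : T → ℕ
  out : List Bool

/-- A piece of a Turing machine; it exits where `δ` is `none`. -/
structure Routine (Γ T : Type) where
  Q : Type
  finiteQ : Finite Q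
  start : Q
  δ : Q → InputSymbol → (T → Γ) → Option (Action Q Γ T)

section Routines

variable {Γ T Q Q' : Type}

def Action.map (f : Q → Q') (a : Action Q Γ T) : Action Q' Γ T where
  next := f a.next
  inputMove := a.inputMove
  write := a.write
  workMove := a.workMove
  output := a.output

/-- The action that only changes the state. -/
def Action.goto (q : Q) (γ : T → Γ) : Action Q Γ T :=
  ⟨q, .stay, γ, fun _ => .stay, none⟩

namespace Data

variable (w : List Bool) (s : ℕ)

/-- The symbols under the work-tape heads. -/
def scanned (d : Data Γ T) : T → Γ := fun t => d.tape t (d.head t)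

def perform (d : Data Γ T) (a : Action Q Γ T) : Data Γ T where
  inputPos := min (w.length + 1) (a.inputMove.apply d.inputPos)
  tape := fun t => Function.update (d.tape t) (d.head t) (a.write t)
  head := fun t => (a.workMove t).apply (d.head t)
  out := d.out ++ a.output.toList

/-- The input head is on the input and the work-tape heads are on the first `s` cells. -/
def Ok (d : Data Γ T) : Prop :=
  d.inputPos ≤ w.length + 1 ∧ ∀ t, d.head t < s

variable {w s}

/-- The clamp on the input head is harmless only for a head that is already on the input; this is
why `Ok` is required. -/
theorem perform_goto {d : Data Γ T} (hd : d.Ok w s) (q : Q) :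
    d.perform w (.goto q d.scanned) = d := by
  ext
  · simp [perform, Action.goto, Move.apply, hd.1]
  · simp [perform, Action.goto, scanned]
  · simp [perform, Action.goto, Move.apply]
  · simp [perform, Action.goto]

end Data

namespace Routine

variable (w : List Bool) (s : ℕ)

/-- The space condition is part of a step, so a single chain of steps certifies both the result and
the space. -/
def Step (R : Routine Γ T) (c c' : R.Q × Data Γ T) : Prop :=
  ∃ a, R.δ c.1 (readInput w c.2.inputPos) c.2.scanned = some a ∧
    c' = (a.next, c.2.perform w a) ∧ c'.2.Ok w s

/-- Started on `d`, the routine exits with `d'`, and its work-tape heads stay on the first `s`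
cells. -/
def Exec (R : Routine Γ T) (d d' : Data Γ T) : Prop :=
  d.Ok w s ∧ ∃ q, ReflTransGen (R.Step w s) (R.start, d) (q, d') ∧
    R.δ q (readInput w d'.inputPos) d'.scanned = none

variable {w s} {R S : Routine Γ T} {d d' d'' : Data Γ T}

theorem reflTransGen_embed (f : R.Q → S.Q)
    (hf : ∀ q x γ a, R.δ q x γ = some a → S.δ (f q) x γ = some (a.map f)) {q q' : R.Q}
    (h : ReflTransGen (R.Step w s) (q, d) (q', d')) :
    ReflTransGen (S.Step w s) (f q, d) (f q', d') := by
  refine ReflTransGen.lift (fun c : R.Q × Data Γ T => (f c.1, c.2)) ?_ _ _ h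
  rintro ⟨q, d⟩ _ ⟨a, ha, rfl, hok⟩
  exact ⟨a.map f, hf _ _ _ _ ha, rfl, hok⟩

theorem step_goto (hd : d.Ok w s) {q q' : R.Q}
    (h : R.δ q (readInput w d.inputPos) d.scanned = some (.goto q' d.scanned)) :
    R.Step w s (q, d) (q', d) :=
  ⟨_, h, by rw [Data.perform_goto hd]; rfl, hd⟩

/-- The routine that performs one action. -/
def op (f : InputSymbol → (T → Γ) → Action Unit Γ T) : Routine Γ T where
  Q := Bool
  finiteQ := inferInstance
  start := false
  δ
    | false, x, γ => some ((f x γ).map fun _ => true)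
    | true, _, _ => none

theorem Exec.op {f : InputSymbol → (T → Γ) → Action Unit Γ T} (hd : d.Ok w s)
    (h : d.perform w (f (readInput w d.inputPos) d.scanned) = d') (hd' : d'.Ok w s) :
    Exec w s (op f) d d' :=
  ⟨hd, true, ReflTransGen.single ⟨_, rfl, Prod.ext rfl h.symm, hd'⟩, rfl⟩

/-- Run `R`, then `S`. -/
def seq (R S : Routine Γ T) : Routine Γ T where
  Q := R.Q ⊕ S.Q
  finiteQ := have := R.finiteQ; have := S.finiteQ; inferInstance
  start := .inl R.start
  δ
    | .inl q, x, γ => match R.δ q x γ with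
      | some a => some (a.map .inl)
      | none => some (.goto (.inr S.start) γ)
    | .inr q, x, γ => (S.δ q x γ).map (Action.map .inr)

theorem Exec.seq (h₁ : Exec w s R d d') (h₂ : Exec w s S d' d'') :
    Exec w s (R.seq S) d d'' := by
  obtain ⟨hd, q, hq, hexit⟩ := h₁
  obtain ⟨hd', q', hq', hexit'⟩ := h₂
  have e₁ := reflTransGen_embed (S := R.seq S) Sum.inl
    (fun q x γ a h => by simp [Routine.seq, h]) hq
  have e₂ := reflTransGen_embed (S := R.seq S) Sum.inr
    (fun q x γ a h => by simp [Routine.seq, h]) hq'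
  refine ⟨hd, .inr q', (e₁.tail (step_goto hd' ?_)).trans e₂, ?_⟩
  · simp [Routine.seq, hexit]
  · simp [Routine.seq, hexit']

/-- Run `R` or `S`, depending on a test. -/
def ite (c : InputSymbol → (T → Γ) → Bool) (R S : Routine Γ T) : Routine Γ T where
  Q := Option (R.Q ⊕ S.Q)
  finiteQ := have := R.finiteQ; have := S.finiteQ; inferInstance
  start := none
  δ
    | none, x, γ => some (.goto (some (if c x γ then .inl R.start else .inr S.start)) γ)
    | some (.inl q), x, γ => (R.δ q x γ).map (Action.map (some ∘ .inl))
    | some (.inr q), x, γ => (S.δ q x γ).map (Action.map (some ∘ .inr))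

theorem Exec.ite {c : InputSymbol → (T → Γ) → Bool}
    (h₁ : c (readInput w d.inputPos) d.scanned = true → Exec w s R d d')
    (h₂ : c (readInput w d.inputPos) d.scanned = false → Exec w s S d d') :
    Exec w s (ite c R S) d d' := by
  cases hc : c (readInput w d.inputPos) d.scanned with
  | true =>
    obtain ⟨hd, q, hq, hexit⟩ := h₁ hc
    have e := reflTransGen_embed (S := Routine.ite c R S) (some ∘ Sum.inl)
      (fun q x γ a h => by simp [Routine.ite, h]) hq
    refine ⟨hd, some (.inl q), e.head (step_goto hd ?_), ?_⟩
    · simp [Routine.ite, hc]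
    · simp [Routine.ite, hexit]
  | false =>
    obtain ⟨hd, q, hq, hexit⟩ := h₂ hc
    have e := reflTransGen_embed (S := Routine.ite c R S) (some ∘ Sum.inr)
      (fun q x γ a h => by simp [Routine.ite, h]) hq
    refine ⟨hd, some (.inr q), e.head (step_goto hd ?_), ?_⟩
    · simp [Routine.ite, hc]
    · simp [Routine.ite, hexit]

/-- Run `R` as long as the test succeeds. -/
def loop (c : InputSymbol → (T → Γ) → Bool) (R : Routine Γ T) : Routine Γ T where
  Q := Option R.Q
  finiteQ := have := R.finiteQ; inferInstance
  start := none
  δ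
    | none, x, γ => if c x γ then some (.goto (some R.start) γ) else none
    | some q, x, γ => match R.δ q x γ with
      | some a => some (a.map some)
      | none => some (.goto none γ)

theorem Exec.loop_exit {c : InputSymbol → (T → Γ) → Bool} (hd : d.Ok w s)
    (hc : c (readInput w d.inputPos) d.scanned = false) : Exec w s (loop c R) d d :=
  ⟨hd, none, ReflTransGen.refl, by simp [loop, hc]⟩

theorem Exec.loop_step {c : InputSymbol → (T → Γ) → Bool}
    (hc : c (readInput w d.inputPos) d.scanned = true) (h₁ : Exec w s R d d')
    (h₂ : Exec w s (loop c R) d' d'') : Exec w s (loop c R) d d'' := by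
  obtain ⟨hd, q, hq, hexit⟩ := h₁
  obtain ⟨hd', q', hq', hexit'⟩ := h₂
  have e := reflTransGen_embed (S := Routine.loop c R) some
    (fun q x γ a h => by simp [Routine.loop, h]) hq
  refine ⟨hd, q', ((e.head (step_goto hd ?_)).tail (step_goto hd' ?_)).trans hq', hexit'⟩
  · simp [Routine.loop, hc]
  · simp [Routine.loop, hexit]

end Routine

end Routines

/-! ### Binary counters -/

/-- The work alphabet. -/
inductive Sym
  | blank
  | zero
  | one
  | mark
  deriving DecidableEq

instance : Finite Sym :=
  Set.finite_univ_iff.1 ((Set.toFinite ({.blank, .zero, .one, .mark} : Set Sym)).subset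
    (by rintro (_|_|_|_) <;> simp))

/-- The binary digits of `v`, least significant digit first, followed by blanks. -/
def binaryDigit : ℕ → ℕ → Sym
  | v, 0 => if v = 0 then .blank else if v % 2 = 1 then .one else .zero
  | v, p + 1 => binaryDigit (v / 2) p

theorem binaryDigit_zero_left (p : ℕ) : binaryDigit 0 p = .blank := by
  induction p with
  | zero => rfl
  | succ p ih => simpa [binaryDigit] using ih

theorem binaryDigit_ne_mark (v p : ℕ) : binaryDigit v p ≠ .mark := by
  induction p generalizing v with
  | zero =>
    unfold binaryDigit
    split_ifs <;> nofun
  | succ p ih => exact ih _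

/-- There are no leading zeros, so one scanned cell decides whether a counter is 0. -/
theorem binaryDigit_zero_eq_blank (v : ℕ) : binaryDigit v 0 = .blank ↔ v = 0 := by
  unfold binaryDigit
  split_ifs <;> simp_all

/-- The tape of a counter: a mark followed by the binary digits. -/
def counterTape (v : ℕ) : ℕ → Sym
  | 0 => .mark
  | p + 1 => binaryDigit v p

section Counters

variable {T : Type} [DecidableEq T] {w : List Bool} {s : ℕ}

/-- The action that touches only tape `t`. -/
def Action.single {Q : Type} (t : T) (q : Q) (x : Sym) (m : Move) (γ : T → Sym) : Action Q Sym T :=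
  ⟨q, .stay, Function.update γ t x, Function.update (fun _ => .stay) t m, none⟩

def Data.setTape (d : Data Sym T) (t : T) (f : ℕ → Sym) (h : ℕ) : Data Sym T where
  inputPos := d.inputPos
  tape := Function.update d.tape t f
  head := Function.update d.head t h
  out := d.out

theorem Data.Ok.setTape {d : Data Sym T} (hd : d.Ok w s) (t : T) (f : ℕ → Sym) {h : ℕ}
    (hh : h < s) : (d.setTape t f h).Ok w s := by
  refine ⟨hd.1, fun t' => ?_⟩
  by_cases ht : t' = t
  · subst ht
    simpa [Data.setTape] using hh
  · simpa [Data.setTape, ht] using hd.2 t'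

theorem Data.scanned_setTape (d : Data Sym T) (t : T) (f : ℕ → Sym) (h : ℕ) :
    (d.setTape t f h).scanned t = f h := by
  simp [Data.setTape, Data.scanned]

theorem Routine.step_single {R : Routine Sym T} {d : Data Sym T} (hd : d.Ok w s) {t : T}
    {f f' : ℕ → Sym} {h h' : ℕ} {q q' : R.Q} {x : Sym} {m : Move}
    (hδ : ∀ y γ, γ t = f h → R.δ q y γ = some (.single t q' x m γ))
    (hf : Function.update f h x = f') (hm : m.apply h = h') (hs : h' < s) :
    R.Step w s (q, d.setTape t f h) (q', d.setTape t f' h') := by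
  refine ⟨_, hδ _ _ (d.scanned_setTape t f h), Prod.ext rfl ?_, hd.setTape t f' hs⟩
  subst hf hm
  ext t' p
  · simp [Data.setTape, Data.perform, Action.single, Move.apply, hd.1]
  · by_cases ht : t' = t
    · subst ht
      simp [Data.setTape, Data.perform, Action.single]
    · simp [Data.setTape, Data.perform, Action.single, Data.scanned, ht]
  · by_cases ht : t' = t
    · subst ht
      simp [Data.setTape, Data.perform, Action.single]
    · simp [Data.setTape, Data.perform, Action.single, ht, Move.apply]
  · simp [Data.setTape, Data.perform, Action.single]

/-- If `back` moves the head of tape `t` left to the mark and then one step right, this brings the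
head to cell 1. -/
theorem Routine.reflTransGen_back {R : Routine Sym T} {d : Data Sym T} (hd : d.Ok w s) {t : T}
    {back done : R.Q} (h₁ : ∀ y γ, γ t = .mark → R.δ back y γ = some (.single t done .mark .right γ))
    (h₂ : ∀ y γ, γ t ≠ .mark → R.δ back y γ = some (.single t back (γ t) .left γ))
    (hs₁ : 1 < s) (v : ℕ) {h : ℕ} (hs : h < s) :
    ReflTransGen (R.Step w s) (back, d.setTape t (counterTape v) h)
      (done, d.setTape t (counterTape v) 1) := by
  induction h with
  | zero =>
    refine ReflTransGen.single (step_single hd (fun y γ hγ => h₁ y γ hγ) ?_ rfl hs₁)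
    exact Function.update_eq_self 0 _
  | succ h ih =>
    refine (ih (by omega)).head (step_single hd (x := binaryDigit v h) (m := .left)
      (fun y γ hγ => ?_) ?_ rfl
      (by simp only [Move.apply]; omega))
    · have hγ : γ t = binaryDigit v h := hγ
      rw [← hγ]
      exact h₂ y γ (hγ ▸ binaryDigit_ne_mark v h)
    · exact Function.update_eq_self (h + 1) (counterTape v)

/-- `f` before cell `h`, and the binary digits of `v` from cell `h` on. -/
def withDigits (f : ℕ → Sym) (h v : ℕ) : ℕ → Sym :=
  fun p => if p < h then f p else binaryDigit v (p - h)

theorem withDigits_one (v v' : ℕ) : withDigits (counterTape v) 1 v' = counterTape v' := by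
  funext p
  cases p <;> simp [withDigits, counterTape]

theorem withDigits_head (f : ℕ → Sym) (h v : ℕ) : withDigits f h v h = binaryDigit v 0 := by
  simp [withDigits]

theorem update_withDigits {f : ℕ → Sym} {h v v' : ℕ} (hv : v / 2 = v' / 2) :
    Function.update (withDigits f h v) h (binaryDigit v' 0) = withDigits f h v' := by
  funext p
  rcases lt_trichotomy p h with hp | rfl | hp
  · simp [withDigits, hp, hp.ne]
  · simp [withDigits]
  · obtain ⟨k, rfl⟩ := Nat.exists_eq_add_of_lt hp
    rw [Function.update_of_ne (by omega)]
    simp only [withDigits]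
    rw [if_neg (by omega), if_neg (by omega),
      show h + k + 1 - h = k + 1 by omega, binaryDigit, binaryDigit, hv]

/-- One step of a carry or borrow: the processed digit joins the fixed prefix, and v / 2 remains to
the right. -/
theorem update_withDigits_succ {f : ℕ → Sym} {h v : ℕ} (x : Sym) :
    Function.update (withDigits f h v) h x =
      withDigits (Function.update f h x) (h + 1) (v / 2) := by
  funext p
  rcases lt_trichotomy p h with hp | rfl | hp
  · simp [withDigits, hp, hp.ne, Nat.lt_succ_of_lt hp]
  · simp [withDigits]
  · obtain ⟨k, rfl⟩ := Nat.exists_eq_add_of_lt hp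
    rw [Function.update_of_ne (by omega)]
    simp only [withDigits]
    rw [if_neg (by omega), if_neg (by omega),
      show h + k + 1 - h = k + 1 by omega, show h + k + 1 - (h + 1) = k by omega, binaryDigit]

theorem withDigits_update_succ {f : ℕ → Sym} {h v v' : ℕ} {x : Sym} (hx : binaryDigit v 0 = x)
    (hv : v' = v / 2) :
    withDigits (Function.update f h x) (h + 1) v' = withDigits f h v := by
  subst hx hv
  rw [← update_withDigits_succ, update_withDigits rfl]

inductive IncState
  | carry
  | back
  | done

instance : Finite IncState :=
  Set.finite_univ_iff.1 ((Set.toFinite ({.carry, .back, .done} : Set IncState)).subset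
    (by rintro (_|_|_) <;> simp))

/-- Add 1 to the counter on tape `t`. -/
def inc (t : T) : Routine Sym T where
  Q := IncState
  finiteQ := inferInstance
  start := .carry
  δ
    | .carry, _, γ => some (if γ t = .one then .single t .carry .zero .right γ
        else .single t .back .one .left γ)
    | .back, _, γ => some (if γ t = .mark then .single t .done .mark .right γ
        else .single t .back (γ t) .left γ)
    | .done, _, _ => none

/-- If v = 2u, the last digit (or a blank) becomes one. If v = 2u + 1, it becomes zero and the carry
continues with u. The bound `2 ^ k` limits how far the head travels. -/
theorem reflTransGen_carry {d : Data Sym T} (hd : d.Ok w s) (t : T) (v : ℕ) {f : ℕ → Sym}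
    {h k : ℕ} (hv : v < 2 ^ k) (hs : h + k < s) :
    ∃ h' < s, ReflTransGen ((inc t).Step w s)
      (IncState.carry, d.setTape t (withDigits f h v) h)
      (IncState.back, d.setTape t (withDigits f h (v + 1)) h') := by
  induction v using Nat.strong_induction_on generalizing f h k with
  | _ v ih =>
  rcases Nat.even_or_odd' v with ⟨u, rfl | rfl⟩
  · refine ⟨h - 1, by omega, ReflTransGen.single (Routine.step_single hd (x := .one) (m := .left)
      (fun y γ hγ => ?_) ?_ rfl
      (by omega))⟩
    · rw [withDigits_head] at hγ
      have : γ t ≠ .one := by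
        rw [hγ, binaryDigit]
        split_ifs with h1 h2
        · nofun
        · omega
        · nofun
      simp [inc, this]
    · rw [← update_withDigits (v := 2 * u) (v' := 2 * u + 1) (by omega)]
      simp [binaryDigit, Nat.add_mod]
  · obtain _ | k := k
    · omega
    rw [pow_succ] at hv
    obtain ⟨h', hh', hr⟩ := ih u (by omega) (f := Function.update f h .zero) (h := h + 1) (k := k)
      (by omega) (by omega)
    refine ⟨h', hh', ?_⟩
    rw [withDigits_update_succ (v := 2 * u + 1 + 1) (v' := u + 1) ?_ (by omega)] at hr
    · refine hr.head (Routine.step_single hd (x := .zero) (m := .right) (fun y γ hγ => ?_) ?_ rfl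
        (by simp only [Move.apply]; omega))
      · rw [withDigits_head] at hγ
        have : γ t = .one := by
          rw [hγ, binaryDigit]
          simp [Nat.add_mod]
        simp [inc, this]
      · rw [update_withDigits_succ]
        congr 1
        omega
    · simp only [binaryDigit]
      rw [if_neg (by omega), if_neg (by omega)]

theorem exec_inc {d : Data Sym T} (hd : d.Ok w s) (t : T) {v k : ℕ} (hv : v < 2 ^ k)
    (hs : k + 1 < s) :
    (inc t).Exec w s (d.setTape t (counterTape v) 1) (d.setTape t (counterTape (v + 1)) 1) := by
  obtain ⟨h', hh', hr⟩ := reflTransGen_carry hd t v (f := counterTape v) (h := 1) hv (by omega)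
  rw [withDigits_one, withDigits_one] at hr
  refine ⟨hd.setTape t _ (by omega), IncState.done, hr.trans ?_, rfl⟩
  exact Routine.reflTransGen_back hd (R := inc t) (fun y γ hγ => by simp [inc, hγ])
    (fun y γ hγ => by simp [inc, hγ]) (by omega) _ hh'

/-- The one that ends the borrow must become a blank if it is the leading digit and a zero
otherwise, to avoid leading zeros. The state `peek` inspects the next cell to tell these cases
apart. -/
inductive DecState
  | borrow
  | peek
  | erase
  | clear
  | back
  | done

instance : Finite DecState :=
  Set.finite_univ_iff.1 ((Set.toFinite ({.borrow, .peek, .erase, .clear, .back, .done} : Set DecState)).subset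
    (by rintro (_|_|_|_|_|_) <;> simp))

/-- Subtract 1 from the counter on tape `t`, which must not be 0. -/
def dec (t : T) : Routine Sym T where
  Q := DecState
  finiteQ := inferInstance
  start := .borrow
  δ
    | .borrow, _, γ => some (if γ t = .one then .single t .peek .one .right γ
        else .single t .borrow .one .right γ)
    | .peek, _, γ => some (.single t (if γ t = .blank then .erase else .clear) (γ t) .left γ)
    | .erase, _, γ => some (.single t .back .blank .left γ)
    | .clear, _, γ => some (.single t .back .zero .left γ)
    | .back, _, γ => some (if γ t = .mark then .single t .done .mark .right γ
        else .single t .back (γ t) .left γ)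
    | .done, _, _ => none

theorem reflTransGen_borrow {d : Data Sym T} (hd : d.Ok w s) (t : T) (v : ℕ) {f : ℕ → Sym}
    {h k : ℕ} (hv : v + 1 < 2 ^ k) (hs : h + k < s) :
    ∃ h' < s, ReflTransGen ((dec t).Step w s)
      (DecState.borrow, d.setTape t (withDigits f h (v + 1)) h)
      (DecState.back, d.setTape t (withDigits f h v) h') := by
  induction v using Nat.strong_induction_on generalizing f h k with
  | _ v ih =>
  obtain _ | k := k
  · omega
  rcases Nat.even_or_odd' v with ⟨u, rfl | rfl⟩
  · have h1 : binaryDigit (2 * u + 1) 0 = .one := by simp [binaryDigit, Nat.add_mod]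
    have h2 : withDigits f h (2 * u + 1) (h + 1) = binaryDigit u 0 := by
      simp only [withDigits, binaryDigit]
      rw [if_neg (by omega), show h + 1 - h = 0 + 1 by omega, binaryDigit, binaryDigit]
      congr 2
      all_goals rw [show (2 * u + 1) / 2 = u by omega]
    refine ⟨h - 1, by omega, .head (Routine.step_single hd (x := .one) (m := .right)
      (f' := withDigits f h (2 * u + 1)) (q' := DecState.peek) (fun y γ hγ => ?_) ?_ rfl
      (by simp only [Move.apply]; omega))
      (.head (Routine.step_single hd (x := binaryDigit u 0) (m := .left)
        (f' := withDigits f h (2 * u + 1)) (q' := if u = 0 then DecState.erase else DecState.clear)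
        (fun y γ hγ => ?_) ?_ rfl (by change h + 1 - 1 < s; omega))
      (.single (Routine.step_single hd (x := binaryDigit (2 * u) 0) (m := .left)
        (fun y γ hγ => ?_) ?_ rfl (by omega))))⟩
    · rw [withDigits_head, h1] at hγ
      simp [dec, hγ]
    · rw [← h1]
      exact update_withDigits rfl
    · rw [show Move.right.apply h = h + 1 from rfl, h2] at hγ
      simp only [dec, hγ, binaryDigit_zero_eq_blank]
    · rw [← h2]
      exact Function.update_eq_self (h + 1) _
    · by_cases hu : u = 0
      · subst hu
        simp [dec, binaryDigit]
      · simp [dec, binaryDigit, hu]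
    · exact update_withDigits (by omega)
  · rw [pow_succ] at hv
    obtain ⟨h', hh', hr⟩ := ih u (by omega) (f := Function.update f h .one) (h := h + 1) (k := k)
      (by omega) (by omega)
    refine ⟨h', hh', ?_⟩
    rw [withDigits_update_succ (v := 2 * u + 1) (v' := u) ?_ (by omega)] at hr
    · refine hr.head (Routine.step_single hd (x := .one) (m := .right) (fun y γ hγ => ?_) ?_ rfl
        (by simp only [Move.apply]; omega))
      · rw [withDigits_head] at hγ
        have : γ t ≠ .one := by
          rw [hγ, binaryDigit, if_neg (by omega), if_neg (by omega)]
          nofun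
        simp [dec, this]
      · rw [update_withDigits_succ]
        congr 1
        omega
    · simp [binaryDigit, Nat.add_mod]

theorem exec_dec {d : Data Sym T} (hd : d.Ok w s) (t : T) {v k : ℕ} (hv : v + 1 < 2 ^ k)
    (hs : k + 1 < s) :
    (dec t).Exec w s (d.setTape t (counterTape (v + 1)) 1) (d.setTape t (counterTape v) 1) := by
  obtain ⟨h', hh', hr⟩ := reflTransGen_borrow hd t v (f := counterTape v) (h := 1) hv (by omega)
  rw [withDigits_one, withDigits_one] at hr
  refine ⟨hd.setTape t _ (by omega), DecState.done, hr.trans ?_, rfl⟩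
  exact Routine.reflTransGen_back hd (R := dec t) (fun y γ hγ => by simp [dec, hγ])
    (fun y γ hγ => by simp [dec, hγ]) (by omega) _ hh'

end Counters

/-! ### From routines to machines -/

/-- The machine that runs a routine on blank work tapes. -/
def Routine.toMachine {Γ T : Type} [Finite Γ] [Finite T] (R : Routine Γ T) (blank : Γ) :
    Machine where
  Q := R.Q
  Γ := Γ
  T := T
  finiteQ := R.finiteQ
  finiteΓ := inferInstance
  finiteT := inferInstance
  start := R.start
  blank := blank
  δ := R.δ

theorem Routine.Exec.toMachine {Γ T : Type} [Finite Γ] [Finite T] {R : Routine Γ T} {blank : Γ}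
    {w : List Bool} {s : ℕ} {d' : Data Γ T}
    (h : R.Exec w s ⟨0, fun _ _ => blank, fun _ => 0, []⟩ d') :
    (R.toMachine blank).Outputs w d'.out ∧ (R.toMachine blank).UsesSpace w s := by
  obtain ⟨hd, q, hq, hexit⟩ := h
  let M := R.toMachine blank
  let cfg : R.Q × Data Γ T → M.Cfg := fun c => ⟨c.1, c.2.inputPos, c.2.tape, c.2.head, c.2.out⟩
  have hstep : ∀ a b, R.Step w s a b → M.step w (cfg a) = some (cfg b) := by
    rintro a _ ⟨act, hact, rfl, -⟩
    change Option.map _ (R.δ a.1 _ a.2.scanned) = _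
    rw [hact]
    rfl
  have hhalt : M.step w (cfg (q, d')) = none := by
    change Option.map _ (R.δ q _ d'.scanned) = _
    rw [hexit]
    rfl
  have hreach : StateTransition.Reaches (M.step w) M.init (cfg (q, d')) :=
    ReflTransGen.lift cfg (fun a b hab => hstep a b hab) _ _ hq
  refine ⟨⟨cfg (q, d'), hreach, hhalt, rfl⟩, ?_⟩
  -- The machine is deterministic and halts at the end of the recorded run, so each reached
  -- configuration lies on that run.
  have key : ∀ a, ReflTransGen (R.Step w s) a (q, d') → a.2.Ok w s → ∀ c,
      StateTransition.Reaches (M.step w) (cfg a) c → ∀ t, c.head t < s := by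
    intro a ha
    induction ha using ReflTransGen.head_induction_on with
    | refl =>
      intro hok c hc
      rcases ReflTransGen.cases_head hc with rfl | ⟨b, hb, -⟩
      · exact hok.2
      · rw [hhalt] at hb
        cases hb
    | @head a b hab _ ih =>
      intro hok c hc
      rcases ReflTransGen.cases_head hc with rfl | ⟨b', hb', hc⟩
      · exact hok.2
      · rw [hstep a b hab] at hb'
        cases hb'
        obtain ⟨_, _, _, hok'⟩ := hab
        exact ih hok' c hc
  exact key _ hq hd

/-! ### Programs on counters -/

/-- An abstract configuration: the position of the input head, the values of the counters, and the
output. -/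
@[ext]
structure State (T : Type) where
  pos : ℕ
  ctr : T → ℕ
  out : List Bool

section Programs

variable {T : Type} {w : List Bool}

def State.toData (σ : State T) : Data Sym T :=
  ⟨σ.pos, fun t => counterTape (σ.ctr t), fun _ => 1, σ.out⟩

/-- The input head is on the input and the counters are at most the length of the input. -/
def State.Valid (w : List Bool) (σ : State T) : Prop :=
  σ.pos ≤ w.length + 1 ∧ ∀ t, σ.ctr t ≤ w.length

/-- The number of work-tape cells that are used on the input `w`. -/
def workSpace (w : List Bool) : ℕ := Nat.log 2 w.length + 3

theorem State.Valid.ok {σ : State T} (h : σ.Valid w) : σ.toData.Ok w (workSpace w) :=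
  ⟨h.1, fun _ => by simp [State.toData, workSpace]⟩

/-- The routine takes `σ` to `σ'`. -/
def Runs (w : List Bool) (R : Routine Sym T) (σ σ' : State T) : Prop :=
  σ.Valid w → σ'.Valid w ∧ R.Exec w (workSpace w) σ.toData σ'.toData

/-- It gives access to the bounds on the initial state while a run is being built. -/
theorem Runs.of_valid {R : Routine Sym T} {σ σ' : State T} (h : σ.Valid w → Runs w R σ σ') :
    Runs w R σ σ' := fun hσ => h hσ hσ

theorem Runs.seq {R S : Routine Sym T} {σ σ' σ'' : State T} (h₁ : Runs w R σ σ')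
    (h₂ : Runs w S σ' σ'') : Runs w (R.seq S) σ σ'' := by
  intro hσ
  obtain ⟨h1, h2⟩ := h₁ hσ
  obtain ⟨h3, h4⟩ := h₂ h1
  exact ⟨h3, h2.seq h4⟩

/-- A test sees the scanned input symbol and which counters are 0. -/
abbrev Test (T : Type) : Type := InputSymbol → (T → Bool) → Bool

def Test.onTapes (c : Test T) (x : InputSymbol) (γ : T → Sym) : Bool :=
  c x fun t => decide (γ t = .blank)

def State.eval (w : List Bool) (σ : State T) (c : Test T) : Bool :=
  c (readInput w σ.pos) fun t => decide (σ.ctr t = 0)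

theorem State.onTapes_eq_eval (σ : State T) (c : Test T) :
    c.onTapes (readInput w σ.toData.inputPos) σ.toData.scanned = σ.eval w c := by
  simp only [Test.onTapes, State.eval, State.toData, Data.scanned, counterTape,
    binaryDigit_zero_eq_blank]

def cond (c : Test T) (R S : Routine Sym T) : Routine Sym T := .ite c.onTapes R S

def whileLoop (c : Test T) (R : Routine Sym T) : Routine Sym T := .loop c.onTapes R

theorem Runs.cond {c : Test T} {R S : Routine Sym T} {σ σ' : State T}
    (h₁ : σ.eval w c = true → Runs w R σ σ') (h₂ : σ.eval w c = false → Runs w S σ σ') :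
    Runs w (cond c R S) σ σ' := by
  intro hσ
  cases hc : σ.eval w c with
  | true =>
    obtain ⟨h, h'⟩ := h₁ hc hσ
    refine ⟨h, .ite (fun _ => h') fun hc' => ?_⟩
    rw [State.onTapes_eq_eval, hc] at hc'
    cases hc'
  | false =>
    obtain ⟨h, h'⟩ := h₂ hc hσ
    refine ⟨h, .ite (fun hc' => ?_) fun _ => h'⟩
    rw [State.onTapes_eq_eval, hc] at hc'
    cases hc'

theorem Runs.whileLoop {c : Test T} {R : Routine Sym T} (N : ℕ) {S : ℕ → State T}
    (hc : ∀ k < N, (S k).eval w c = true) (hR : ∀ k < N, Runs w R (S k) (S (k + 1)))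
    (hN : (S N).eval w c = false) : Runs w (whileLoop c R) (S 0) (S N) := by
  induction N generalizing S with
  | zero =>
    intro hσ
    refine ⟨hσ, .loop_exit hσ.ok ?_⟩
    rwa [State.onTapes_eq_eval]
  | succ N ih =>
    intro hσ
    obtain ⟨h1, h2⟩ := hR 0 (by omega) hσ
    obtain ⟨h3, h4⟩ := ih (S := fun k => S (k + 1)) (fun k hk => hc _ (by omega))
      (fun k hk => hR _ (by omega)) hN h1
    refine ⟨h3, .loop_step ?_ h2 h4⟩
    rw [State.onTapes_eq_eval]
    exact hc 0 (by omega)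

/-- Move the input head and append to the output. -/
def act (m : Move) (b : Option Bool) : Routine Sym T :=
  .op fun _ γ => ⟨(), m, γ, fun _ => .stay, b⟩

theorem Runs.act (m : Move) (b : Option Bool) (σ : State T) (h : m.apply σ.pos ≤ w.length + 1) :
    Runs w (act m b) σ ⟨m.apply σ.pos, σ.ctr, σ.out ++ b.toList⟩ := by
  intro hσ
  have hv : State.Valid w ⟨m.apply σ.pos, σ.ctr, σ.out ++ b.toList⟩ := ⟨h, hσ.2⟩
  refine ⟨hv, .op hσ.ok ?_ hv.ok⟩
  ext
  · simpa [State.toData, Data.perform] using h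
  · simp [State.toData, Data.perform, Data.scanned]
  · simp [State.toData, Data.perform, Move.apply]
  · simp [State.toData, Data.perform]

/-- The test whether counter `t` is not 0. -/
def nonzero (t : T) : Test T := fun _ z => !z t

theorem State.eval_nonzero (σ : State T) (t : T) :
    σ.eval w (nonzero t) = decide (σ.ctr t ≠ 0) := by
  simp [State.eval, nonzero]

variable [DecidableEq T]

theorem State.toData_update (σ : State T) (t : T) (v : ℕ) :
    State.toData ⟨σ.pos, Function.update σ.ctr t v, σ.out⟩ =
      σ.toData.setTape t (counterTape v) 1 := by
  ext t' p
  · rfl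
  · by_cases ht : t' = t
    · subst ht
      simp [State.toData, Data.setTape]
    · simp [State.toData, Data.setTape, ht]
  · simp [State.toData, Data.setTape]
  · rfl

theorem State.toData_eq_setTape (σ : State T) (t : T) :
    σ.toData = σ.toData.setTape t (counterTape (σ.ctr t)) 1 := by
  rw [← State.toData_update, Function.update_eq_self]

theorem Runs.inc (t : T) (σ : State T) (h : σ.ctr t < w.length) :
    Runs w (inc t) σ ⟨σ.pos, Function.update σ.ctr t (σ.ctr t + 1), σ.out⟩ := by
  intro hσ
  refine ⟨⟨hσ.1, fun t' => ?_⟩, ?_⟩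
  · by_cases ht : t' = t
    · subst ht
      simpa using h
    · simpa [ht] using hσ.2 t'
  · have hlog := Nat.lt_pow_succ_log_self (b := 2) (by norm_num) w.length
    -- Values up to the input length have at most log + 1 digits; with the mark and one spare cell
    -- they fill `workSpace`.
    have := exec_inc hσ.ok t (v := σ.ctr t) (k := Nat.log 2 w.length + 1) (h.trans hlog)
      (by simp [workSpace])
    rwa [← State.toData_eq_setTape, ← State.toData_update] at this

theorem Runs.dec (t : T) (σ : State T) (h : σ.ctr t ≠ 0) :
    Runs w (dec t) σ ⟨σ.pos, Function.update σ.ctr t (σ.ctr t - 1), σ.out⟩ := by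
  intro hσ
  obtain ⟨v, hv⟩ := Nat.exists_eq_succ_of_ne_zero h
  refine ⟨⟨hσ.1, fun t' => ?_⟩, ?_⟩
  · by_cases ht : t' = t
    · subst ht
      simpa using (Nat.sub_le _ _).trans (hσ.2 t')
    · simpa [ht] using hσ.2 t'
  · have hlog := Nat.lt_pow_succ_log_self (b := 2) (by norm_num) w.length
    have := exec_dec hσ.ok t (v := v) (k := Nat.log 2 w.length + 1)
      ((hv ▸ hσ.2 t).trans_lt hlog) (by simp [workSpace])
    rw [← Nat.succ_eq_add_one, ← hv, ← State.toData_eq_setTape, ← State.toData_update] at this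
    rwa [hv, Nat.succ_sub_one]

/-! ### Comparing two counters -/

/-- The counters `x` and `y` decreased by `k`, which is kept in `z`. -/
def shiftDown (c : T → ℕ) (x y z : T) (k : ℕ) : T → ℕ :=
  fun t => if t = x then c x - k else if t = y then c y - k else if t = z then k else c t

/-- Compare the counters `x` and `y` with the help of `z`, which must be 0, and run `R` or `S`. -/
def ifEq (x y z : T) (R S : Routine Sym T) : Routine Sym T :=
  let restore := whileLoop (nonzero z) ((dec z).seq ((inc x).seq (inc y)))
  (whileLoop (fun _ zero => !zero x && !zero y) ((dec x).seq ((dec y).seq (inc z)))).seq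
    (cond (fun _ zero => zero x && zero y) (restore.seq R) (restore.seq S))

/-- After a common descent by the minimum, the counters were equal iff both are now 0. The test
precedes the restoring loop, which would destroy its outcome, so each branch restores separately. -/
theorem Runs.ifEq {x y z : T} {R S : Routine Sym T} {σ σ' : State T} (hxy : x ≠ y) (hxz : x ≠ z)
    (hyz : y ≠ z) (hz : σ.ctr z = 0) (h₁ : σ.ctr x = σ.ctr y → Runs w R σ σ')
    (h₂ : σ.ctr x ≠ σ.ctr y → Runs w S σ σ') : Runs w (ifEq x y z R S) σ σ' := by
  refine Runs.of_valid fun hσ => ?_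
  let A : ℕ → State T := fun k => ⟨σ.pos, shiftDown σ.ctr x y z k, σ.out⟩
  have hA0 : A 0 = σ := by
    ext t
    · rfl
    · simp only [A, shiftDown]
      split_ifs with h1 h2 h3 <;> simp [*]
    · rfl
  set N := min (σ.ctr x) (σ.ctr y) with hN
  have hx := hσ.2 x
  have hy := hσ.2 y
  have hdown : Runs w (AHP.whileLoop (fun _ zero => !zero x && !zero y)
      ((AHP.dec x).seq ((AHP.dec y).seq (AHP.inc z)))) (A 0) (A N) := by
    refine Runs.whileLoop N (fun k hk => ?_) (fun k hk => ?_) ?_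
    · simp [State.eval, A, shiftDown, hxy.symm]
      omega
    · have e : A (k + 1) = ⟨σ.pos, Function.update (Function.update (Function.update (A k).ctr x
          (σ.ctr x - k - 1)) y (σ.ctr y - k - 1)) z (k + 1), σ.out⟩ := by
        ext t
        · rfl
        · simp only [A, shiftDown, Function.update_apply]
          split_ifs <;> first | omega | simp_all
        · rfl
      rw [e]
      have r1 := Runs.dec (w := w) x (A k) (by simp [A, shiftDown]; omega)
      have r2 := Runs.dec (w := w) y ⟨σ.pos, Function.update (A k).ctr x ((A k).ctr x - 1), σ.out⟩
        (by simp [A, shiftDown, hxy.symm]; omega)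
      have r3 := Runs.inc (w := w) z ⟨σ.pos, Function.update (Function.update (A k).ctr x
        (σ.ctr x - k - 1)) y (σ.ctr y - k - 1), σ.out⟩
        (by simp [A, shiftDown, hxz.symm, hyz.symm]; omega)
      simp [A, shiftDown, hxz.symm, hyz.symm, hxy.symm] at r1 r2 r3 ⊢
      exact r1.seq (r2.seq r3)
    · simp [State.eval, A, shiftDown, hxy.symm]
      omega
  have hup : Runs w (AHP.whileLoop (nonzero z) ((AHP.dec z).seq ((AHP.inc x).seq (AHP.inc y))))
      (A N) σ := by
    rw [← hA0]
    have := Runs.whileLoop (w := w) (c := nonzero z)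
      (R := (AHP.dec z).seq ((AHP.inc x).seq (AHP.inc y))) N
      (S := fun k => A (N - k)) (fun k hk => ?_) (fun k hk => ?_) ?_
    · simpa using this
    · simp [State.eval_nonzero, A, shiftDown, hxz.symm, hyz.symm]
      omega
    · obtain ⟨j, hj⟩ : ∃ j, N - k = j + 1 := ⟨N - k - 1, by omega⟩
      rw [show N - (k + 1) = j by omega, hj]
      have e : A j = ⟨σ.pos, Function.update (Function.update (Function.update (A (j + 1)).ctr z
          j) x (σ.ctr x - (j + 1) + 1)) y (σ.ctr y - (j + 1) + 1), σ.out⟩ := by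
        ext t
        · rfl
        · simp only [A, shiftDown, Function.update_apply]
          split_ifs <;> first | omega | simp_all
        · rfl
      rw [e]
      have r1 := Runs.dec (w := w) z (A (j + 1)) (by simp [A, shiftDown, hxz.symm, hyz.symm])
      have r2 := Runs.inc (w := w) x ⟨σ.pos, Function.update (A (j + 1)).ctr z j, σ.out⟩
        (by simp [A, shiftDown, hxz]; omega)
      have r3 := Runs.inc (w := w) y ⟨σ.pos, Function.update (Function.update (A (j + 1)).ctr z j) x
        (σ.ctr x - (j + 1) + 1), σ.out⟩
        (by simp [A, shiftDown, hxy.symm, hyz]; omega)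
      simp [A, shiftDown, hxz, hyz, hxz.symm, hyz.symm, hxy.symm] at r1 r2 r3 ⊢
      exact r1.seq (r2.seq r3)
    · simp [State.eval_nonzero, A, shiftDown, hxz.symm, hyz.symm]
  rw [hA0] at hdown
  refine hdown.seq (Runs.cond (fun h => hup.seq (h₁ ?_)) (fun h => hup.seq (h₂ ?_)))
  · simp [State.eval, A, shiftDown, hxy.symm] at h
    omega
  · simp [State.eval, A, shiftDown, hxy.symm] at h
    omega

end Programs

/-! ### Counting loops -/

section Loops

variable {X : Type} {w : List Bool}

/-- Whatever the input position and the output so far, the routine appends `l` to the output and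
changes nothing else. -/
def Emits (w : List Bool) (R : Routine Sym (X × Bool)) (c : X × Bool → ℕ) (l : List Bool) : Prop :=
  ∀ p out, Runs w R ⟨p, c, out⟩ ⟨p, c, out ++ l⟩

theorem Emits.seq {R S : Routine Sym (X × Bool)} {c : X × Bool → ℕ} {l l' : List Bool}
    (h₁ : Emits w R c l) (h₂ : Emits w S c l') : Emits w (R.seq S) c (l ++ l') := by
  intro p out
  rw [← List.append_assoc]
  exact (h₁ p out).seq (h₂ p _)

def output (b : Bool) : Routine Sym (X × Bool) := act .stay (some b)

theorem Emits.output (b : Bool) (c : X × Bool → ℕ) : Emits w (output b) c [b] :=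
  fun p out => Runs.of_valid fun hv => Runs.act .stay (some b) ⟨p, c, out⟩ hv.1

variable [DecidableEq X]

/-- The counters in round `k` of a loop with loop variable `x` and `N` rounds: the counter
`(x, false)` has the rounds that are done and `(x, true)` those that remain. -/
def loopRound (c : X × Bool → ℕ) (x : X) (N k : ℕ) : X × Bool → ℕ :=
  fun t => if t = (x, false) then k else if t = (x, true) then N - k else c t

/-- Run `R` for the values `0, …, N - 1` of the loop variable, where `N` is the initial value of
`(x, true)`. -/
def forLoop (x : X) (R : Routine Sym (X × Bool)) : Routine Sym (X × Bool) :=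
  (whileLoop (nonzero (x, true)) (R.seq ((dec (x, true)).seq (inc (x, false))))).seq
    (whileLoop (nonzero (x, false)) ((dec (x, false)).seq (inc (x, true))))

/-- `S k` describes the state around round k with the loop counters in their resting position;
`loopRound` overlays their actual values. The second loop returns them to rest, so that the loop can
run again inside another one. -/
theorem Runs.forLoop {x : X} {R : Routine Sym (X × Bool)} (N : ℕ) {S : ℕ → State (X × Bool)}
    (hS : ∀ k ≤ N, (S k).ctr (x, false) = 0 ∧ (S k).ctr (x, true) = N)
    (hR : ∀ k < N, Runs w R ⟨(S k).pos, loopRound (S k).ctr x N k, (S k).out⟩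
      ⟨(S (k + 1)).pos, loopRound (S (k + 1)).ctr x N k, (S (k + 1)).out⟩) :
    Runs w (forLoop x R) (S 0) (S N) := by
  refine Runs.of_valid fun hv => ?_
  have hNw : N ≤ w.length := (hS 0 (by omega)).2 ▸ hv.2 (x, true)
  let A : ℕ → State (X × Bool) := fun k => ⟨(S k).pos, loopRound (S k).ctr x N k, (S k).out⟩
  have hA0 : A 0 = S 0 := by
    ext t
    · rfl
    · simp only [A, loopRound]
      split_ifs with h1 h2
      · rw [h1, (hS 0 (by omega)).1]
      · rw [h2, (hS 0 (by omega)).2, Nat.sub_zero]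
      · rfl
    · rfl
  have h1 : Runs w (AHP.whileLoop (nonzero (x, true))
      (R.seq ((AHP.dec (x, true)).seq (AHP.inc (x, false))))) (A 0) (A N) := by
    refine Runs.whileLoop N (fun k hk => ?_) (fun k hk => (hR k hk).seq ?_) ?_
    · simp [State.eval_nonzero, A, loopRound]
      omega
    · have e : A (k + 1) = ⟨(S (k + 1)).pos, Function.update (Function.update
          (loopRound (S (k + 1)).ctr x N k) (x, true) (N - k - 1)) (x, false) (k + 1),
          (S (k + 1)).out⟩ := by
        ext t
        · rfl
        · simp only [A, loopRound, Function.update_apply]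
          split_ifs <;> omega
        · rfl
      rw [e]
      have r1 := Runs.dec (w := w) (x, true)
        ⟨(S (k + 1)).pos, loopRound (S (k + 1)).ctr x N k, (S (k + 1)).out⟩
        (by simp [loopRound]; omega)
      have r2 := Runs.inc (w := w) (x, false) ⟨(S (k + 1)).pos, Function.update
        (loopRound (S (k + 1)).ctr x N k) (x, true) (N - k - 1), (S (k + 1)).out⟩
        (by simp [loopRound]; omega)
      simp [loopRound] at r1 r2 ⊢
      exact r1.seq r2
    · simp [State.eval_nonzero, A, loopRound]
  have h2 : Runs w (AHP.whileLoop (nonzero (x, false))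
      ((AHP.dec (x, false)).seq (AHP.inc (x, true)))) (A N) (S N) := by
    let B : ℕ → State (X × Bool) := fun k => ⟨(S N).pos, loopRound (S N).ctr x N (N - k), (S N).out⟩
    have hBN : B N = S N := by
      ext t
      · rfl
      · simp only [B, loopRound]
        split_ifs with h1 h2
        · rw [h1, (hS N le_rfl).1, Nat.sub_self]
        · rw [h2, (hS N le_rfl).2, Nat.sub_self, Nat.sub_zero]
        · rfl
      · rfl
    have hB : Runs w (AHP.whileLoop (nonzero (x, false))
      ((AHP.dec (x, false)).seq (AHP.inc (x, true)))) (B 0) (B N) := by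
      refine Runs.whileLoop N (fun k hk => ?_) (fun k hk => ?_) ?_
      · simp [State.eval_nonzero, B, loopRound]
        omega
      · obtain ⟨j, hj⟩ : ∃ j, N - k = j + 1 := ⟨N - k - 1, by omega⟩
        have e : B (k + 1) = ⟨(S N).pos, Function.update (Function.update
            (loopRound (S N).ctr x N (j + 1)) (x, false) j) (x, true) (N - (j + 1) + 1),
            (S N).out⟩ := by
          ext t
          · rfl
          · simp only [B, loopRound, Function.update_apply, show N - (k + 1) = j by omega]
            split_ifs <;> first | omega | simp_all
          · rfl
        rw [e]
        have r1 := Runs.dec (w := w) (x, false) (B k) (by simp [B, loopRound]; omega)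
        have r2 := Runs.inc (w := w) (x, true) ⟨(S N).pos, Function.update
          (loopRound (S N).ctr x N (j + 1)) (x, false) j, (S N).out⟩
          (by simp [loopRound]; omega)
        simp [loopRound, B, hj] at r1 r2 ⊢
        exact r1.seq r2
      · simp [State.eval_nonzero, B, loopRound]
    rwa [hBN] at hB
  rw [hA0] at h1
  exact h1.seq h2

theorem Emits.forLoop {x : X} {R : Routine Sym (X × Bool)} {c : X × Bool → ℕ} {N : ℕ}
    {f : ℕ → List Bool} (h₀ : c (x, false) = 0) (hN : c (x, true) = N)
    (hR : ∀ k < N, Emits w R (loopRound c x N k) (f k)) :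
    Emits w (forLoop x R) c ((List.range N).flatMap f) := by
  intro p out
  have := Runs.forLoop (w := w) (x := x) (R := R) N
    (S := fun k => ⟨p, c, out ++ (List.range k).flatMap f⟩) (fun _ _ => ⟨h₀, hN⟩) fun k hk => by
      have := hR k hk p (out ++ (List.range k).flatMap f)
      simpa [List.range_succ] using this
  simpa using this

theorem Emits.ifEq {x y z : X × Bool} {R S : Routine Sym (X × Bool)} {c : X × Bool → ℕ}
    {l : List Bool} (hxy : x ≠ y) (hxz : x ≠ z) (hyz : y ≠ z) (hz : c z = 0)
    (h₁ : c x = c y → Emits w R c l) (h₂ : c x ≠ c y → Emits w S c l) :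
    Emits w (ifEq x y z R S) c l :=
  fun p out => Runs.ifEq hxy hxz hyz hz (fun h => h₁ h p out) (fun h => h₂ h p out)

end Loops

/-! ### The program -/

/-- The variables of the program: `v, i, j` and `v', i', j'` for the row and the column of a matrix
entry, `v, u` for an arc, `l` for the glue vertices, `e` for the number of an arc, and `s` for
comparisons. -/
inductive Var
  | v
  | i
  | j
  | v'
  | i'
  | j'
  | u
  | l
  | e
  | s
  deriving DecidableEq

instance : Finite Var :=
  Set.finite_univ_iff.1 ((Set.toFinite ({.v, .i, .j, .v', .i', .j', .u, .l, .e, .s} : Set Var)).subset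
    (by rintro (_ | _ | _ | _ | _ | _ | _ | _ | _ | _) <;> simp))

abbrev Ctr : Type := Var × Bool

/-- The counters outside all loops. -/
def ctrs (n M m e : ℕ) : Ctr → ℕ
  | (.v, true) | (.v', true) | (.u, true) => n
  | (.i, true) | (.j, true) | (.i', true) | (.j', true) => M
  | (.l, true) => m
  | (.e, false) => e
  | _ => 0

section Auxiliary

variable {T X : Type} {w : List Bool}

def noop : Routine Sym T := act .stay none

theorem Runs.noop (σ : State T) : Runs w noop σ σ :=
  Runs.of_valid fun hv => by
    have := Runs.act .stay none σ hv.1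
    simp only [Option.toList_none, List.append_nil] at this
    exact this

theorem Emits.condNonzero {x : X × Bool} {R S : Routine Sym (X × Bool)} {c : X × Bool → ℕ}
    {l : List Bool} (h₁ : c x ≠ 0 → Emits w R c l) (h₂ : c x = 0 → Emits w S c l) :
    Emits w (cond (nonzero x) R S) c l := by
  intro p out
  refine Runs.cond (fun h => h₁ ?_ p out) (fun h => h₂ ?_ p out)
  · simpa [State.eval_nonzero] using h
  · simpa [State.eval_nonzero] using h

variable [DecidableEq T] [DecidableEq X]

/-- Add 1 to each of the counters in the list. -/
def incs : List T → Routine Sym T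
  | [] => noop
  | t :: l => (inc t).seq (incs l)

theorem Runs.incs (l : List T) (σ : State T) {c : T → ℕ} (hc : ∀ t, c t = σ.ctr t + l.count t)
    (h : ∀ t ∈ l, c t ≤ w.length) : Runs w (incs l) σ ⟨σ.pos, c, σ.out⟩ := by
  induction l generalizing σ with
  | nil =>
    obtain rfl : c = σ.ctr := funext fun t => by simpa using hc t
    exact Runs.noop σ
  | cons t l ih =>
    refine Runs.seq (Runs.inc t σ ?_)
      (ih ⟨σ.pos, Function.update σ.ctr t (σ.ctr t + 1), σ.out⟩ (fun t' => ?_)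
        (fun t' ht' => h t' (by simp [ht'])))
    · have h1 := hc t
      have h2 := h t (by simp)
      rw [List.count_cons_self] at h1
      omega
    · rw [hc t', List.count_cons]
      by_cases ht : t' = t
      · subst ht
        simp
        omega
      · simp [ht, Ne.symm ht]

/-- Test whether counter `y` is one more than counter `x`. -/
def ifSucc (x y z : T) (R S : Routine Sym T) : Routine Sym T :=
  (inc x).seq (ifEq x y z ((dec x).seq R) ((dec x).seq S))

theorem Emits.ifSucc {x y z : X × Bool} {R S : Routine Sym (X × Bool)} {c : X × Bool → ℕ}
    {l : List Bool} (hxy : x ≠ y) (hxz : x ≠ z) (hyz : y ≠ z) (hz : c z = 0) (hx : c x < w.length)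
    (h₁ : c y = c x + 1 → Emits w R c l) (h₂ : c y ≠ c x + 1 → Emits w S c l) :
    Emits w (ifSucc x y z R S) c l := by
  intro p out
  have hdec : ∀ out, Runs w (dec x) ⟨p, Function.update c x (c x + 1), out⟩ ⟨p, c, out⟩ := by
    intro out
    simpa using Runs.dec (w := w) x ⟨p, Function.update c x (c x + 1), out⟩ (by simp)
  refine (Runs.inc x ⟨p, c, out⟩ hx).seq (Runs.ifEq hxy hxz hyz ?_ (fun h => ?_) (fun h => ?_))
  · simpa [hxz.symm] using hz
  · refine (hdec out).seq (h₁ ?_ p out)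
    simpa [hxy.symm] using h.symm
  · refine (hdec out).seq (h₂ ?_ p out)
    simpa [hxy.symm, eq_comm] using h

end Auxiliary

/-! ### Matrix entries and matrix rows -/

variable {w : List Bool}

/-- The matrix entry for two grid vertices. -/
def gridGrid (v i j v' i' j' : ℕ) : Bool :=
  decide (v = v' ∧ ((i = i' ∧ j' = j + 1) ∨ (j = j' ∧ i' = i + 1)))

/-- The matrix entry for the glue vertex of the arc `(v, u)` with number `e` and a grid vertex. -/
def glueGrid (v u e v' i' j' : ℕ) : Bool :=
  decide ((v' = v ∧ i' = e ∧ j' = 0) ∨ (v' = u ∧ i' = 0 ∧ j' = e))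

def gridGridRoutine : Routine Sym Ctr :=
  ifEq (.v, false) (.v', false) (.s, false)
    (ifEq (.i, false) (.i', false) (.s, false)
      (ifSucc (.j, false) (.j', false) (.s, false) (output true) (output false))
      (ifEq (.j, false) (.j', false) (.s, false)
        (ifSucc (.i, false) (.i', false) (.s, false) (output true) (output false))
        (output false)))
    (output false)

theorem emits_gridGridRoutine {c : Ctr → ℕ} (hs : c (.s, false) = 0)
    (hi : c (.i, false) < w.length) (hj : c (.j, false) < w.length) :
    Emits w gridGridRoutine c [gridGrid (c (.v, false)) (c (.i, false)) (c (.j, false))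
      (c (.v', false)) (c (.i', false)) (c (.j', false))] := by
  have hout : ∀ b b' : Bool, b = b' → Emits w (output b) c [b'] := by
    rintro b _ rfl
    exact Emits.output b c
  unfold gridGrid
  refine Emits.ifEq (by simp) (by simp) (by simp) hs (fun hv => ?_) fun hv => hout _ _ (by simp [hv])
  refine Emits.ifEq (by simp) (by simp) (by simp) hs (fun hii => ?_) fun hii => ?_
  · refine Emits.ifSucc (by simp) (by simp) (by simp) hs hj (fun h => ?_) fun h => ?_
    · exact hout _ _ (by simp [*])
    · exact hout _ _ (by simp [*])
  · refine Emits.ifEq (by simp) (by simp) (by simp) hs (fun hjj => ?_) fun hjj => ?_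
    · refine Emits.ifSucc (by simp) (by simp) (by simp) hs hi (fun h => ?_) fun h => ?_
      · exact hout _ _ (by simp [*])
      · exact hout _ _ (by simp [*])
    · exact hout _ _ (by simp [*])

/-- The second alternative of `glueGrid`, to which `glueGridRoutine` falls through when a condition
of the first fails. -/
def glueHeadRoutine : Routine Sym Ctr :=
  ifEq (.v', false) (.u, false) (.s, false)
    (ifEq (.j', false) (.e, false) (.s, false)
      (cond (nonzero (.i', false)) (output false) (output true)) (output false))
    (output false)

def glueGridRoutine : Routine Sym Ctr :=
  ifEq (.v', false) (.v, false) (.s, false)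
    (ifEq (.i', false) (.e, false) (.s, false)
      (cond (nonzero (.j', false)) glueHeadRoutine (output true)) glueHeadRoutine)
    glueHeadRoutine

theorem emits_glueGridRoutine {c : Ctr → ℕ} (hs : c (.s, false) = 0) :
    Emits w glueGridRoutine c [glueGrid (c (.v, false)) (c (.u, false)) (c (.e, false))
      (c (.v', false)) (c (.i', false)) (c (.j', false))] := by
  have hout : ∀ b b' : Bool, b = b' → Emits w (output b) c [b'] := by
    rintro b _ rfl
    exact Emits.output b c
  have hhead : ∀ b' : Bool, decide (c (.v', false) = c (.u, false) ∧ c (.i', false) = 0 ∧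
      c (.j', false) = c (.e, false)) = b' → Emits w glueHeadRoutine c [b'] := by
    rintro _ rfl
    refine Emits.ifEq (by simp) (by simp) (by simp) hs (fun h1 => ?_)
      fun h1 => hout _ _ (by simp [h1])
    refine Emits.ifEq (by simp) (by simp) (by simp) hs (fun h2 => ?_)
      fun h2 => hout _ _ (by simp [h2])
    exact Emits.condNonzero (fun h3 => hout _ _ (by simp [h3])) fun h3 => hout _ _ (by simp [*])
  unfold glueGrid
  refine Emits.ifEq (by simp) (by simp) (by simp) hs (fun h1 => ?_)
    fun h1 => hhead _ (by simp [h1])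
  refine Emits.ifEq (by simp) (by simp) (by simp) hs (fun h2 => ?_)
    fun h2 => hhead _ (by simp [h2])
  exact Emits.condNonzero (fun h3 => hhead _ (by simp [h3])) fun h3 => hout _ _ (by simp [*])

/-- The values of `f` on the grid vertices in lexicographic order. -/
def gridWord (n M : ℕ) (f : ℕ → ℕ → ℕ → List Bool) : List Bool :=
  (List.range n).flatMap fun v => (List.range M).flatMap fun i => (List.range M).flatMap fun j =>
    f v i j

/-- A row of the matrix: the entries `f` for the grid vertices, and 0 for the glue vertices. -/
def rowWord (n m : ℕ) (f : ℕ → ℕ → ℕ → Bool) : List Bool :=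
  gridWord n (m + 1) (fun v i j => [f v i j]) ++ (List.range m).flatMap fun _ => [false]

def rowRoutine (R : Routine Sym Ctr) : Routine Sym Ctr :=
  (forLoop .v' (forLoop .i' (forLoop .j' R))).seq (forLoop .l (output false))

theorem emits_rowRoutine {R : Routine Sym Ctr} {c : Ctr → ℕ} {n m : ℕ} {f : ℕ → ℕ → ℕ → Bool}
    (hv : c (.v', false) = 0) (hv' : c (.v', true) = n)
    (hi : c (.i', false) = 0) (hi' : c (.i', true) = m + 1)
    (hj : c (.j', false) = 0) (hj' : c (.j', true) = m + 1)
    (hl : c (.l, false) = 0) (hl' : c (.l, true) = m)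
    (hR : ∀ v < n, ∀ i < m + 1, ∀ j < m + 1, Emits w R
      (loopRound (loopRound (loopRound c .v' n v) .i' (m + 1) i) .j' (m + 1) j) [f v i j]) :
    Emits w (rowRoutine R) c (rowWord n m f) := by
  refine Emits.seq (Emits.forLoop hv hv' fun v hv => Emits.forLoop ?_ ?_ fun i hi =>
    Emits.forLoop ?_ ?_ fun j hj => hR v hv i hi j hj)
    (Emits.forLoop hl hl' fun _ _ => Emits.output _ _)
  all_goals simp [loopRound, *]

/-! ### Reading the input -/

/-- The input: `n` and `K` in unary and the matrix `g`. -/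
structure IsInput (w : List Bool) (n K : ℕ) (g : ℕ → ℕ → Bool) : Prop where
  length : w.length = n + 1 + n * n + K
  unary : ∀ k < n, w[k]? = some true
  separator : w[n]? = some false
  matrix : ∀ a < n, ∀ b < n, w[n + 1 + (a * n + b)]? = some (g a b)
  bound : ∀ k < K, w[n + 1 + n * n + k]? = some true

/-- The number of arcs among the first `k` entries of the matrix. -/
def arcCount (n : ℕ) (g : ℕ → ℕ → Bool) (k : ℕ) : ℕ :=
  Nat.count (fun j => g (j / n) (j % n) = true) k

theorem arcCount_succ {n a b : ℕ} (g : ℕ → ℕ → Bool) (hb : b < n) :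
    arcCount n g (a * n + (b + 1)) = arcCount n g (a * n + b) + if g a b then 1 else 0 := by
  have hn : 0 < n := by omega
  rw [arcCount, arcCount, ← add_assoc, Nat.count_succ, mul_comm, Nat.mul_add_div hn,
    Nat.div_eq_of_lt hb, Nat.mul_add_mod, Nat.mod_eq_of_lt hb, add_zero]

/-- The test whether the scanned input symbol is 1. -/
def isOne : Test Ctr := fun x _ => match x with
  | .bit b => b
  | _ => false

theorem eval_isOne {p : ℕ} {b : Bool} (h : w[p]? = some b) (c : Ctr → ℕ) (out : List Bool) :
    State.eval w ⟨1 + p, c, out⟩ isOne = b := by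
  simp [State.eval, isOne, Nat.add_comm 1, readInput, h]

def countVertices : Routine Sym Ctr :=
  whileLoop isOne ((incs [(.v, true), (.v', true), (.u, true)]).seq (act .right none))

theorem runs_countVertices {n K : ℕ} {g : ℕ → ℕ → Bool} (hw : IsInput w n K g) :
    Runs w countVertices ⟨1, ctrs 0 0 0 0, []⟩ ⟨1 + n, ctrs n 0 0 0, []⟩ := by
  have hlen := hw.length
  refine Runs.whileLoop n (S := fun k => ⟨1 + k, ctrs k 0 0 0, []⟩) (fun k hk => ?_)
    (fun k hk => ?_) ?_
  · exact eval_isOne (hw.unary k hk) _ _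
  · have h1 := Runs.incs (w := w) [(.v, true), (.v', true), (.u, true)]
      ⟨1 + k, ctrs k 0 0 0, []⟩ (c := ctrs (k + 1) 0 0 0)
      (by rintro ⟨x, b⟩; cases x <;> cases b <;> simp [ctrs]) (by simp [ctrs]; omega)
    have h2 := Runs.act (w := w) .right none ⟨1 + k, ctrs (k + 1) 0 0 0, []⟩
      (by simp [Move.apply]; omega)
    simpa [Move.apply, add_assoc] using h1.seq h2
  · exact eval_isOne hw.separator _ _

def countArcs : Routine Sym Ctr :=
  forLoop .v (forLoop .u
    ((cond isOne (incs [(.i, true), (.j, true), (.i', true), (.j', true), (.l, true)]) noop).seq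
      (act .right none)))

theorem runs_countArcs {n K : ℕ} {g : ℕ → ℕ → Bool} (hw : IsInput w n K g) :
    Runs w countArcs ⟨1 + (n + 1), ctrs n 0 0 0, []⟩
      ⟨1 + (n + 1 + n * n), ctrs n (arcCount n g (n * n)) (arcCount n g (n * n)) 0, []⟩ := by
  unfold countArcs
  have hlen := hw.length
  have hcount : ∀ k, arcCount n g k ≤ k := fun k => Nat.count_le _
  -- The counters after k matrix entries have been read.
  let C : ℕ → Ctr → ℕ := fun k => ctrs n (arcCount n g k) (arcCount n g k) 0
  have main := Runs.forLoop (w := w) (x := Var.v) (R := forLoop .u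
    ((cond isOne (incs [(.i, true), (.j, true), (.i', true), (.j', true), (.l, true)]) noop).seq
      (act .right none))) n (S := fun a => ⟨1 + (n + 1 + a * n), C (a * n), []⟩)
    (fun a _ => by simp [C, ctrs]) (fun a ha => ?_)
  · simpa [C, arcCount] using main
  · have inner := Runs.forLoop (w := w) (x := Var.u)
      (R := (cond isOne (incs [(.i, true), (.j, true), (.i', true), (.j', true), (.l, true)])
        noop).seq (act .right none)) n
      (S := fun b => ⟨1 + (n + 1 + (a * n + b)), loopRound (C (a * n + b)) .v n a, []⟩)
      (fun b _ => by simp [C, ctrs, loopRound]) (fun b hb => ?_)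
    · simpa [Nat.succ_mul] using inner
    · have hlt : a * n + b < n * n := by nlinarith
      have hread := eval_isOne (hw.matrix a ha b hb)
        (loopRound (loopRound (C (a * n + b)) .v n a) .u n b) []
      have h2 := fun c : Ctr → ℕ => Runs.act (w := w) .right none
        ⟨1 + (n + 1 + (a * n + b)), c, []⟩ (by simp [Move.apply]; omega)
      simp only [Move.apply, Option.toList_none, List.append_nil] at h2
      refine Runs.seq ?_ (h2 _)
      have hsucc := arcCount_succ (a := a) g hb
      refine Runs.cond (fun h => ?_) (fun h => ?_)
      · rw [hread] at h
        rw [h, if_pos rfl] at hsucc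
        have hk := hcount (a * n + b)
        have h1 := Runs.incs (w := w)
          [(.i, true), (.j, true), (.i', true), (.j', true), (.l, true)]
          ⟨1 + (n + 1 + (a * n + b)), loopRound (loopRound (C (a * n + b)) .v n a) .u n b, []⟩
          (c := loopRound (loopRound (C (a * n + (b + 1))) .v n a) .u n b)
          (by rintro ⟨x, b⟩; cases x <;> cases b <;> simp [C, ctrs, loopRound, hsucc])
          (by simp [C, ctrs, loopRound, hsucc]; omega)
        exact h1
      · rw [hread] at h
        rw [h] at hsucc
        simp only [C, hsucc]
        exact Runs.noop _

/-- Move the input head back to the beginning of the matrix. -/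
def rewind : Routine Sym Ctr := forLoop .v (forLoop .u (act .left none))

theorem runs_rewind {n K : ℕ} {g : ℕ → ℕ → Bool} (hw : IsInput w n K g) (m : ℕ) :
    Runs w rewind ⟨1 + (n + 1 + n * n), ctrs n m m 0, []⟩ ⟨1 + (n + 1), ctrs n m m 0, []⟩ := by
  unfold rewind
  have hlen := hw.length
  have main := Runs.forLoop (w := w) (x := Var.v) (R := forLoop .u (act .left none)) n
    (S := fun a => ⟨1 + (n + 1 + (n * n - a * n)), ctrs n m m 0, []⟩)
    (fun a _ => by simp [ctrs]) (fun a ha => ?_)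
  · simpa using main
  · have inner := Runs.forLoop (w := w) (x := Var.u) (R := act .left none) n
      (S := fun b => ⟨1 + (n + 1 + (n * n - (a * n + b))), loopRound (ctrs n m m 0) .v n a, []⟩)
      (fun b _ => by simp [ctrs, loopRound]) (fun b hb => ?_)
    · simpa [Nat.succ_mul] using inner
    · have hlt : a * n + b < n * n := by nlinarith
      have h := Runs.act (w := w) .left none ⟨1 + (n + 1 + (n * n - (a * n + b))),
        loopRound (loopRound (ctrs n m m 0) .v n a) .u n b, []⟩ (by simp [Move.apply]; omega)
      simp only [Move.apply, Option.toList_none, List.append_nil] at h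
      rwa [show 1 + (n + 1 + (n * n - (a * n + b))) - 1 =
        1 + (n + 1 + (n * n - (a * n + (b + 1)))) by omega] at h

/-! ### Writing the output -/

/-- The number of vertices in unary, followed by the separator. -/
def headerRoutine : Routine Sym Ctr :=
  (forLoop .v (forLoop .i (forLoop .j (output true)))).seq
    ((forLoop .l (output true)).seq (output false))

def headerWord (n m : ℕ) : List Bool :=
  gridWord n (m + 1) (fun _ _ _ => [true]) ++ (((List.range m).flatMap fun _ => [true]) ++ [false])

theorem emits_headerRoutine (n m : ℕ) :
    Emits w headerRoutine (ctrs n (m + 1) m 0) (headerWord n m) :=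
  Emits.seq (Emits.forLoop rfl rfl fun _ _ => Emits.forLoop rfl rfl fun _ _ =>
    Emits.forLoop rfl rfl fun _ _ => Emits.output _ _)
    (Emits.seq (Emits.forLoop rfl rfl fun _ _ => Emits.output _ _) (Emits.output _ _))

def gridRowsRoutine : Routine Sym Ctr :=
  forLoop .v (forLoop .i (forLoop .j (rowRoutine gridGridRoutine)))

def gridRowsWord (n m : ℕ) : List Bool :=
  gridWord n (m + 1) fun v i j => rowWord n m (gridGrid v i j)

theorem emits_gridRowsRoutine {n m : ℕ} (hm : m < w.length) :
    Emits w gridRowsRoutine (ctrs n (m + 1) m 0) (gridRowsWord n m) := by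
  refine Emits.forLoop rfl rfl fun v hv => Emits.forLoop rfl rfl fun i hi =>
    Emits.forLoop rfl rfl fun j hj => emits_rowRoutine rfl rfl rfl rfl rfl rfl rfl rfl
      fun v' hv' i' hi' j' hj' => ?_
  refine emits_gridGridRoutine rfl ?_ ?_
  · change i < w.length
    omega
  · change j < w.length
    omega

def glueRowRoutine : Routine Sym Ctr :=
  (inc (.e, false)).seq (rowRoutine glueGridRoutine)

def glueRowsRoutine : Routine Sym Ctr :=
  forLoop .v (forLoop .u ((cond isOne glueRowRoutine noop).seq (act .right none)))

/-- The row for the arc `(a, b)`, if there is one. -/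
def glueRowWord (n m : ℕ) (g : ℕ → ℕ → Bool) (a b : ℕ) : List Bool :=
  if g a b then rowWord n m (glueGrid a b (arcCount n g (a * n + b) + 1)) else []

def glueRowsWord (n m : ℕ) (g : ℕ → ℕ → Bool) : List Bool :=
  (List.range n).flatMap fun a => (List.range n).flatMap fun b => glueRowWord n m g a b

/-- The matrix is scanned a second time. The counter `e` is raised before the row of an arc is
written, so it holds one more than the number of earlier arcs, which is `arcNumber`. -/
theorem runs_glueRowsRoutine {n K m : ℕ} {g : ℕ → ℕ → Bool} (hw : IsInput w n K g)
    (out : List Bool) :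
    Runs w glueRowsRoutine ⟨1 + (n + 1), ctrs n (m + 1) m 0, out⟩
      ⟨1 + (n + 1 + n * n), ctrs n (m + 1) m (arcCount n g (n * n)),
        out ++ glueRowsWord n m g⟩ := by
  unfold glueRowsRoutine glueRowsWord
  have hlen := hw.length
  have hcount : ∀ k, arcCount n g k ≤ k := fun k => Nat.count_le _
  let C : ℕ → Ctr → ℕ := fun k => ctrs n (m + 1) m (arcCount n g k)
  let O : ℕ → List Bool := fun a => out ++ (List.range a).flatMap fun a =>
    (List.range n).flatMap fun b => glueRowWord n m g a b
  have main := Runs.forLoop (w := w) (x := Var.v)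
    (R := forLoop .u ((cond isOne glueRowRoutine noop).seq (act .right none))) n
    (S := fun a => ⟨1 + (n + 1 + a * n), C (a * n), O a⟩)
    (fun a _ => by simp [C, ctrs]) (fun a ha => ?_)
  · simpa [C, O, arcCount] using main
  · have inner := Runs.forLoop (w := w) (x := Var.u)
      (R := (cond isOne glueRowRoutine noop).seq (act .right none)) n
      (S := fun b => ⟨1 + (n + 1 + (a * n + b)), loopRound (C (a * n + b)) .v n a,
        O a ++ (List.range b).flatMap fun b => glueRowWord n m g a b⟩)
      (fun b _ => by simp [C, ctrs, loopRound]) (fun b hb => ?_)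
    · simpa [Nat.succ_mul, O, List.range_succ] using inner
    · have hlt : a * n + b < n * n := by nlinarith
      set out' := O a ++ (List.range b).flatMap fun b => glueRowWord n m g a b with hout'
      have hread := eval_isOne (hw.matrix a ha b hb)
        (loopRound (loopRound (C (a * n + b)) .v n a) .u n b) out'
      have h2 := fun (c : Ctr → ℕ) (out : List Bool) => Runs.act (w := w) .right none
        ⟨1 + (n + 1 + (a * n + b)), c, out⟩ (by simp [Move.apply]; omega)
      simp only [Move.apply, Option.toList_none, List.append_nil] at h2
      refine Runs.seq ?_ (h2 _ _)
      have hsucc := arcCount_succ (a := a) g hb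
      refine Runs.cond (fun h => ?_) (fun h => ?_)
      · rw [hread] at h
        rw [h, if_pos rfl] at hsucc
        have hk := hcount (a * n + b)
        have h1 := Runs.inc (w := w) (.e, false)
          ⟨1 + (n + 1 + (a * n + b)), loopRound (loopRound (C (a * n + b)) .v n a) .u n b, out'⟩
          (by simp [C, ctrs, loopRound]; omega)
        have e : Function.update (loopRound (loopRound (C (a * n + b)) .v n a) .u n b) (.e, false)
            (loopRound (loopRound (C (a * n + b)) .v n a) .u n b (.e, false) + 1) =
            loopRound (loopRound (C (a * n + (b + 1))) .v n a) .u n b := by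
          funext ⟨x, b⟩
          cases x <;> cases b <;> simp [C, ctrs, loopRound, hsucc]
        simp only [e] at h1
        have hrow : Emits w (rowRoutine glueGridRoutine)
            (loopRound (loopRound (C (a * n + (b + 1))) .v n a) .u n b)
            (glueRowWord n m g a b) := by
          rw [glueRowWord, h, if_pos rfl, ← hsucc]
          exact emits_rowRoutine rfl rfl rfl rfl rfl rfl rfl rfl
            fun v' hv' i' hi' j' hj' => emits_glueGridRoutine rfl
        unfold glueRowRoutine
        simpa [List.range_succ, hout'] using h1.seq (hrow _ _)
      · rw [hread] at h
        rw [h] at hsucc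
        have : glueRowWord n m g a b = [] := by simp [glueRowWord, h]
        simp only [C, hsucc, List.range_succ, List.flatMap_append, List.flatMap_singleton, this,
          List.append_nil]
        exact Runs.noop _

def copyBound : Routine Sym Ctr := whileLoop isOne (act .right (some true))

theorem runs_copyBound {n K : ℕ} {g : ℕ → ℕ → Bool} (hw : IsInput w n K g) (c : Ctr → ℕ)
    (out : List Bool) :
    Runs w copyBound ⟨1 + (n + 1 + n * n), c, out⟩
      ⟨1 + (n + 1 + n * n + K), c, out ++ List.replicate K true⟩ := by
  unfold copyBound
  have hlen := hw.length
  have := Runs.whileLoop (w := w) (c := isOne) (R := act .right (some true)) K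
    (S := fun k => ⟨1 + (n + 1 + n * n + k), c, out ++ List.replicate k true⟩) (fun k hk => ?_)
    (fun k hk => ?_) ?_
  · simpa using this
  · exact eval_isOne (hw.bound k hk) _ _
  · have := Runs.act (w := w) .right (some true)
      ⟨1 + (n + 1 + n * n + k), c, out ++ List.replicate k true⟩ (by simp [Move.apply]; omega)
    simpa [Move.apply, List.replicate_succ', add_assoc] using this
  · have : w[n + 1 + n * n + K]? = none := by
      rw [List.getElem?_eq_none_iff]
      omega
    simp [State.eval, isOne, Nat.add_comm 1, readInput, this]

def mainRoutine : Routine Sym Ctr :=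
  countVertices.seq <| (act .right none).seq <| countArcs.seq <| rewind.seq <|
    (incs [(.i, true), (.j, true), (.i', true), (.j', true)]).seq <|
    headerRoutine.seq <| gridRowsRoutine.seq <| glueRowsRoutine.seq <| copyBound.seq <|
    -- These are the n(m+1) ones that turn K into the new bound.
    forLoop .v (forLoop .i (output true))

/-- The output of the program. -/
def mainWord (n m K : ℕ) (g : ℕ → ℕ → Bool) : List Bool :=
  headerWord n m ++ gridRowsWord n m ++ glueRowsWord n m g ++ List.replicate K true ++
    (List.range n).flatMap fun _ => (List.range (m + 1)).flatMap fun _ => [true]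

theorem runs_mainRoutine {n K : ℕ} {g : ℕ → ℕ → Bool} (hw : IsInput w n K g) :
    ∃ p c, Runs w mainRoutine ⟨1, ctrs 0 0 0 0, []⟩
      ⟨p, c, mainWord n (arcCount n g (n * n)) K g⟩ := by
  have hlen := hw.length
  set m := arcCount n g (n * n) with hm
  have hmn : m ≤ n * n := Nat.count_le _
  have h1 := Runs.act (w := w) .right none ⟨1 + n, ctrs n 0 0 0, []⟩ (by simp [Move.apply]; omega)
  simp only [Move.apply, Option.toList_none, List.append_nil, add_assoc] at h1
  -- The grid indices run from 0 to m, so their loops need m + 1 rounds.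
  have h2 := Runs.incs (w := w) [(.i, true), (.j, true), (.i', true), (.j', true)]
    ⟨1 + (n + 1), ctrs n m m 0, []⟩ (c := ctrs n (m + 1) m 0)
    (by rintro ⟨x, b⟩; cases x <;> cases b <;> simp [ctrs]) (by simp [ctrs]; omega)
  exact ⟨_, _, (runs_countVertices hw).seq <| h1.seq <| (runs_countArcs hw).seq <|
    (runs_rewind hw m).seq <| h2.seq <| (emits_headerRoutine n m _ _).seq <|
    (emits_gridRowsRoutine (by omega) _ _).seq <| (runs_glueRowsRoutine hw _).seq <|
    (runs_copyBound hw _ _).seq <|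
    (Emits.forLoop rfl rfl fun _ _ => Emits.forLoop rfl rfl fun _ _ => Emits.output _ _) _ _⟩

/-- Mark the first cell of each work tape, and move all heads one cell to the right. -/
def initRoutine : Routine Sym Ctr :=
  .op fun _ _ => ⟨(), .right, fun _ => .mark, fun _ => .right, none⟩

/-- The reduction is computed by a machine that uses logarithmic space. -/
theorem exists_machine : ∃ (M : Machine) (C : ℕ), ∀ (w : List Bool) (n K : ℕ) (g : ℕ → ℕ → Bool),
    IsInput w n K g → M.Outputs w (mainWord n (arcCount n g (n * n)) K g) ∧
      M.UsesSpace w (C * (Nat.log 2 w.length + 1)) := by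
  -- The constant 3 comes from log + 3 ≤ 3(log + 1).
  refine ⟨(initRoutine.seq mainRoutine).toMachine .blank, 3, fun w n K g hw => ?_⟩
  have hlen := hw.length
  obtain ⟨p, c, hrun⟩ := runs_mainRoutine hw
  have hv : State.Valid w ⟨1, ctrs 0 0 0 0, []⟩ := by
    refine ⟨by simp, ?_⟩
    rintro ⟨x, b⟩
    cases x <;> cases b <;> simp [ctrs]
  have hinit : initRoutine.Exec w (workSpace w) ⟨0, fun _ _ => .blank, fun _ => 0, []⟩
      (State.toData ⟨1, ctrs 0 0 0 0, []⟩) := by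
    refine .op ⟨by simp, by simp [workSpace]⟩ ?_ hv.ok
    ext t q
    · simp [Data.perform, State.toData, Move.apply]
    · have : ctrs 0 0 0 0 t = 0 := by
        obtain ⟨x, b⟩ := t
        cases x <;> cases b <;> rfl
      cases q <;> simp [Data.perform, State.toData, this, counterTape, binaryDigit_zero_left]
    · simp [Data.perform, State.toData, Move.apply]
    · simp [Data.perform, State.toData]
  obtain ⟨h1, h2⟩ := (hinit.seq (hrun hv).2).toMachine
  refine ⟨h1, fun c hc t => (h2 c hc t).trans_le ?_⟩
  simp only [workSpace]
  omega

/-! ### The reduction -/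

section Reduction

variable {n : ℕ} (G : Digraph (Fin n))

open Classical in
/-- The adjacency matrix. -/
noncomputable def matrixEntry (a b : ℕ) : Bool :=
  decide (∃ (ha : a < n) (hb : b < n), G.Adj ⟨a, ha⟩ ⟨b, hb⟩)

theorem matrixEntry_iff (a b : Fin n) : matrixEntry G a b = true ↔ G.Adj a b := by
  simp [matrixEntry]

/-- The arcs are numbered row by row. -/
noncomputable def arcNumber (a : Arc G) : ℕ :=
  arcCount n (matrixEntry G) (a.1.1 * n + a.1.2) + 1

theorem pairIndex_lt (a b : Fin n) : (a * n + b : ℕ) < n * n := by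
  have := a.2
  have := b.2
  nlinarith

theorem matrixEntry_pairIndex {a b : Fin n} (h : G.Adj a b) :
    matrixEntry G ((a * n + b : ℕ) / n) ((a * n + b : ℕ) % n) = true := by
  rw [mul_comm, Nat.mul_add_div (by have := a.2; omega), Nat.div_eq_of_lt b.2, Nat.mul_add_mod,
    Nat.mod_eq_of_lt b.2, add_zero, matrixEntry_iff]
  exact h

/-- The position an + b in the matrix identifies the pair (a, b), by division with remainder. -/
theorem arcCount_eq_numArcs : arcCount n (matrixEntry G) (n * n) = numArcs G := by
  classical
  rw [arcCount, Nat.count_eq_card_filter_range, numArcs, ← Nat.card_eq_finsetCard]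
  symm
  refine Nat.card_congr (Equiv.ofBijective (fun a : Arc G => ⟨a.1.1 * n + a.1.2, ?_⟩) ⟨?_, ?_⟩)
  · simp only [Finset.mem_filter, Finset.mem_range]
    exact ⟨pairIndex_lt _ _, matrixEntry_pairIndex G a.2⟩
  · rintro ⟨⟨a, b⟩, h⟩ ⟨⟨a', b'⟩, h'⟩ heq
    have heq : (a * n + b : ℕ) = a' * n + b' := congrArg Subtype.val heq
    have hn : 0 < n := by have := a.2; omega
    have h1 := congrArg (· / n) heq
    have h2 := congrArg (· % n) heq
    simp only [mul_comm _ n, Nat.mul_add_div hn, Nat.div_eq_of_lt b.2, Nat.div_eq_of_lt b'.2,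
      Nat.mul_add_mod, Nat.mod_eq_of_lt b.2, Nat.mod_eq_of_lt b'.2] at h1 h2
    obtain rfl : a = a' := Fin.ext (by omega)
    obtain rfl : b = b' := Fin.ext h2
    rfl
  · rintro ⟨k, hk⟩
    simp only [Finset.mem_filter, Finset.mem_range] at hk
    obtain ⟨hkn, hk⟩ := hk
    have hn : 0 < n := by
      rcases Nat.eq_zero_or_pos n with rfl | hn
      · omega
      · exact hn
    refine ⟨⟨(⟨k / n, (Nat.div_lt_iff_lt_mul hn).2 hkn⟩, ⟨k % n, Nat.mod_lt _ hn⟩),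
      (matrixEntry_iff G _ _).1 hk⟩, Subtype.ext ?_⟩
    simp [mul_comm, Nat.div_add_mod]

/-- The count of earlier arcs separates any two arcs and is less than the total at each arc. -/
theorem isArcNumbering_arcNumber : IsArcNumbering G (arcNumber G) := by
  constructor
  · rintro ⟨⟨a, b⟩, h⟩ ⟨⟨a', b'⟩, h'⟩ heq
    have heq : (a * n + b : ℕ) = a' * n + b' :=
      Nat.count_injective (matrixEntry_pairIndex G h) (matrixEntry_pairIndex G h')
        (Nat.succ_injective heq)
    have hn : 0 < n := by have := a.2; omega
    have h1 := congrArg (· / n) heq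
    have h2 := congrArg (· % n) heq
    simp only [mul_comm _ n, Nat.mul_add_div hn, Nat.div_eq_of_lt b.2, Nat.div_eq_of_lt b'.2,
      Nat.mul_add_mod, Nat.mod_eq_of_lt b.2, Nat.mod_eq_of_lt b'.2] at h1 h2
    obtain rfl : a = a' := Fin.ext (by omega)
    obtain rfl : b = b' := Fin.ext h2
    rfl
  · intro a
    refine ⟨Nat.le_add_left _ _, ?_⟩
    rw [← arcCount_eq_numArcs]
    exact Nat.count_strict_mono (matrixEntry_pairIndex G a.2) (pairIndex_lt _ _)

open Classical in
/-- The arcs, row by row. -/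
noncomputable def arcList : List (Arc G) :=
  (List.finRange n).flatMap fun a => (List.finRange n).flatMap fun b =>
    if h : G.Adj a b then [⟨(a, b), h⟩] else []

theorem mem_arcList (a : Arc G) : a ∈ arcList G := by
  simp only [arcList, List.mem_flatMap, List.mem_finRange, true_and]
  exact ⟨a.1.1, a.1.2, by simp [a.2]⟩

theorem nodup_arcList : (arcList G).Nodup := by
  classical
  refine List.nodup_flatMap.2 ⟨fun a _ => List.nodup_flatMap.2 ⟨fun b _ => ?_, ?_⟩, ?_⟩
  · split_ifs <;> simp
  · refine (List.nodup_finRange n).imp fun {b b'} hne => ?_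
    rw [Function.onFun, List.disjoint_left]
    intro x hx hx'
    split_ifs at hx hx' <;> simp_all
  · refine (List.nodup_finRange n).imp fun {a a'} hne => ?_
    rw [Function.onFun, List.disjoint_left]
    intro x hx hx'
    simp only [List.mem_flatMap, List.mem_finRange, true_and] at hx hx'
    obtain ⟨b, hb⟩ := hx
    obtain ⟨b', hb'⟩ := hx'
    split_ifs at hb hb' <;> simp_all

theorem length_arcList : (arcList G).length = numArcs G := by
  classical
  rw [numArcs, ← Nat.card_fin (arcList G).length]
  exact Nat.card_congr ((nodup_arcList G).getEquivOfForallMemList _ (mem_arcList G))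

/-- The grid vertices of `P(G, e)` in lexicographic order. -/
noncomputable def gridList : List (PVertex G) :=
  (List.finRange n).flatMap fun v => (List.finRange (numArcs G + 1)).flatMap fun i =>
    (List.finRange (numArcs G + 1)).map fun j => .grid v i j

/-- The vertices of `P(G, e)`. -/
noncomputable def vertexList : List (PVertex G) :=
  gridList G ++ (arcList G).map .glue

theorem mem_vertexList (x : PVertex G) : x ∈ vertexList G := by
  cases x with
  | grid v i j => simp [vertexList, gridList]
  | glue a => simp [vertexList, mem_arcList]

theorem nodup_vertexList : (vertexList G).Nodup := by
  refine List.nodup_append'.2 ⟨?_, (nodup_arcList G).map fun a b h => PVertex.glue.inj h, ?_⟩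
  · refine List.nodup_flatMap.2 ⟨fun v _ => List.nodup_flatMap.2 ⟨fun i _ => ?_, ?_⟩, ?_⟩
    · exact (List.nodup_finRange _).map fun j j' h => by simpa using h
    · refine (List.nodup_finRange _).imp fun {i i'} hne => ?_
      rw [Function.onFun, List.disjoint_left]
      simp only [List.mem_map, List.mem_finRange, true_and]
      rintro _ ⟨j, rfl⟩ ⟨j', h⟩
      exact hne (PVertex.grid.inj h).2.1.symm
    · refine (List.nodup_finRange _).imp fun {v v'} hne => ?_
      rw [Function.onFun, List.disjoint_left]
      simp only [List.mem_flatMap, List.mem_map, List.mem_finRange, true_and]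
      rintro _ ⟨i, j, rfl⟩ ⟨i', j', h⟩
      exact hne (PVertex.grid.inj h).1.symm
  · rw [List.disjoint_left]
    simp only [gridList, List.mem_flatMap, List.mem_map, List.mem_finRange, true_and]
    rintro _ ⟨v, i, j, rfl⟩ ⟨a, -, h⟩
    cases h

theorem length_vertexList :
    (vertexList G).length = n * ((numArcs G + 1) * (numArcs G + 1)) + numArcs G := by
  simp [vertexList, gridList, length_arcList, List.length_flatMap]

/-- `P(G, e)` with its vertices numbered. -/
noncomputable def reductionDigraph : Digraph (Fin (vertexList G).length) where
  Adj x y := (P G (arcNumber G)).Adj ((vertexList G).get x) ((vertexList G).get y)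

open Classical in
noncomputable def reductionIso : (reductionDigraph G).Adj ≃r (P G (arcNumber G)).Adj where
  toEquiv := (nodup_vertexList G).getEquivOfForallMemList _ (mem_vertexList G)
  map_rel_iff' := Iff.rfl

/-! ### The encodings -/

/-- It links the `Fin`-indexed lists of the encoding with the loops of the program, which run over
`ℕ`. -/
theorem flatMap_finRange {α : Type*} (k : ℕ) {f : Fin k → List α} {f' : ℕ → List α}
    (h : ∀ i, f i = f' i) : (List.finRange k).flatMap f = (List.range k).flatMap f' := by
  rw [← List.map_coe_finRange_eq_range, List.flatMap_map]
  exact List.flatMap_congr fun i _ => h i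

theorem flatMap_gridList {f : PVertex G → List Bool} {f' : ℕ → ℕ → ℕ → List Bool}
    (h : ∀ v i j, f (.grid v i j) = f' v i j) :
    (gridList G).flatMap f = gridWord n (numArcs G + 1) f' := by
  simp only [gridList, List.flatMap_assoc, List.flatMap_map]
  exact flatMap_finRange _ fun v => flatMap_finRange _ fun i => flatMap_finRange _ fun j => h v i j

theorem flatMap_arcList {f : Arc G → List Bool} {f' : ℕ → ℕ → List Bool}
    (h : ∀ a, f a = f' a.1.1 a.1.2) :
    (arcList G).flatMap f = (List.range n).flatMap fun a => (List.range n).flatMap fun b =>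
      if matrixEntry G a b then f' a b else [] := by
  simp only [arcList, List.flatMap_assoc]
  refine flatMap_finRange _ fun a => flatMap_finRange _ fun b => ?_
  by_cases hab : G.Adj a b
  · rw [dif_pos hab, if_pos ((matrixEntry_iff G a b).2 hab), List.flatMap_singleton, h]
  · rw [dif_neg hab, if_neg fun h => hab ((matrixEntry_iff G a b).1 h), List.flatMap_nil]

-- The glue vertices are sources, so their columns contribute the zeros at the end of each row.
open Classical in
theorem map_vertexList {x : PVertex G} {f : ℕ → ℕ → ℕ → Bool}
    (h : ∀ v i j, (P G (arcNumber G)).Adj x (.grid v i j) ↔ f v i j = true) :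
    ((vertexList G).map fun y => decide ((P G (arcNumber G)).Adj x y)) =
      rowWord n (numArcs G) f := by
  rw [List.map_eq_flatMap, vertexList, List.flatMap_append, rowWord,
    flatMap_gridList G (f' := fun v i j => [f v i j])]
  · congr 1
    rw [List.flatMap_map, ← length_arcList, ← List.map_eq_flatMap, ← List.map_eq_flatMap,
      List.map_const', List.length_range, ← List.map_const']
    refine List.map_congr_left fun a _ => ?_
    simp [not_adj_glue x a]
  · intro v i j
    simp [h]

theorem adj_grid_iff (v v' : Fin n) (i j i' j' : Fin (numArcs G + 1)) :
    (P G (arcNumber G)).Adj (.grid v i j) (.grid v' i' j') ↔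
      gridGrid v i j v' i' j' = true := by
  simp only [gridGrid, decide_eq_true_eq]
  constructor
  · rintro (⟨_, _, _, _, h⟩ | ⟨_, _, _, _, h⟩)
    · exact ⟨rfl, Or.inl ⟨rfl, h⟩⟩
    · exact ⟨rfl, Or.inr ⟨rfl, h⟩⟩
  · rintro ⟨h, ⟨h1, h2⟩ | ⟨h1, h2⟩⟩
    · obtain rfl := Fin.ext h
      obtain rfl := Fin.ext h1
      exact .row _ _ _ _ h2
    · obtain rfl := Fin.ext h
      obtain rfl := Fin.ext h1
      exact .column _ _ _ _ h2

theorem adj_glue_iff (a : Arc G) (v : Fin n) (i j : Fin (numArcs G + 1)) :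
    (P G (arcNumber G)).Adj (.glue a) (.grid v i j) ↔
      glueGrid a.1.1 a.1.2 (arcNumber G a) v i j = true := by
  simp only [glueGrid, decide_eq_true_eq]
  constructor
  · rintro (_ | _ | ⟨_, _, h⟩ | ⟨_, _, h⟩)
    · exact Or.inl ⟨rfl, h, rfl⟩
    · exact Or.inr ⟨rfl, rfl, h⟩
  · rintro (⟨h, h1, h2⟩ | ⟨h, h1, h2⟩)
    · obtain rfl := Fin.ext h
      obtain rfl : j = 0 := Fin.ext h2
      exact .toTail _ _ h1
    · obtain rfl := Fin.ext h
      obtain rfl : i = 0 := Fin.ext h1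
      exact .toHead _ _ h2

theorem flatMap_range_replicate (k c : ℕ) (b : Bool) :
    ((List.range k).flatMap fun _ => List.replicate c b) = List.replicate (k * c) b := by
  induction k with
  | zero => simp
  | succ k ih =>
    rw [List.range_succ, List.flatMap_append, ih, List.flatMap_singleton,
      List.replicate_append_replicate, Nat.succ_mul]

theorem headerWord_eq (n m : ℕ) :
    headerWord n m = List.replicate (n * ((m + 1) * (m + 1)) + m) true ++ [false] := by
  have h := fun k => flatMap_range_replicate k 1 true
  simp only [List.replicate_one, mul_one] at h
  simp only [headerWord, gridWord, h, flatMap_range_replicate, ← List.append_assoc,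
    List.replicate_append_replicate]

-- `vertexList` has the order in which the program writes rows and columns, so the word agrees block
-- by block: header, grid rows, glue rows, bound.
open Classical in
theorem encode_reductionDigraph (K : ℕ) :
    encodeDigraph (reductionDigraph G) (K + n * (numArcs G + 1)) =
      mainWord n (numArcs G) K (matrixEntry G) := by
  have hmatrix : ((List.finRange (vertexList G).length).flatMap fun x =>
      (List.finRange (vertexList G).length).map fun y => decide ((reductionDigraph G).Adj x y)) =
      gridRowsWord n (numArcs G) ++ glueRowsWord n (numArcs G) (matrixEntry G) := by
    have h1 : ∀ f : PVertex G → List Bool, ((List.finRange (vertexList G).length).flatMap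
        fun x => f ((vertexList G).get x)) = (vertexList G).flatMap f := fun f => by
      conv_rhs => rw [← List.map_get_finRange (vertexList G), List.flatMap_map]
    have h2 : ∀ f : PVertex G → Bool, ((List.finRange (vertexList G).length).map
        fun x => f ((vertexList G).get x)) = (vertexList G).map f := fun f => by
      conv_rhs => rw [← List.map_get_finRange (vertexList G), List.map_map]
      rfl
    refine Eq.trans ?_ ((h1 fun x => (vertexList G).map fun y =>
      decide ((P G (arcNumber G)).Adj x y)).trans ?_)
    · refine List.flatMap_congr fun x _ => ?_
      exact h2 fun y => decide ((P G (arcNumber G)).Adj ((vertexList G).get x) y)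
    · rw [vertexList, List.flatMap_append, ← vertexList, List.flatMap_map]
      congr 1
      · exact flatMap_gridList G fun v i j => map_vertexList G fun v' i' j' =>
          adj_grid_iff G v v' i j i' j'
      · refine flatMap_arcList G (f' := fun a b => rowWord n (numArcs G) (glueGrid a b
          (arcCount n (matrixEntry G) (a * n + b) + 1))) fun a => ?_
        exact map_vertexList G fun v i j => adj_glue_iff G a v i j
  rw [encodeDigraph, mainWord, hmatrix, headerWord_eq, length_vertexList, List.replicate_add K]
  have h := fun k => flatMap_range_replicate k 1 true
  simp only [List.replicate_one, mul_one] at h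
  simp only [h, flatMap_range_replicate, List.append_assoc]

theorem getElem?_flatMap_range {c : ℕ} {f : ℕ → List Bool} (hf : ∀ a, (f a).length = c)
    {k a b : ℕ} (ha : a < k) (hb : b < c) :
    ((List.range k).flatMap f)[a * c + b]? = (f a)[b]? := by
  have hlen : ∀ k, ((List.range k).flatMap f).length = k * c := fun k => by
    simp [List.length_flatMap, hf]
  induction k with
  | zero => omega
  | succ k ih =>
    rw [List.range_succ, List.flatMap_append, List.flatMap_singleton]
    rcases Nat.lt_succ_iff_lt_or_eq.1 ha with h | rfl
    · rw [List.getElem?_append_left, ih h]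
      rw [hlen]
      nlinarith
    · rw [List.getElem?_append_right (by rw [hlen]; omega), hlen, Nat.add_sub_cancel_left]

open Classical in
theorem encodeDigraph_eq (K : ℕ) :
    encodeDigraph G K = List.replicate n true ++ ([false] ++
      (((List.range n).flatMap fun a => (List.range n).map fun b => matrixEntry G a b) ++
      List.replicate K true)) := by
  rw [encodeDigraph, flatMap_finRange n
    (f' := fun a => (List.range n).map fun b => matrixEntry G a b)]
  · simp only [List.append_assoc]
  · intro a
    rw [← List.map_coe_finRange_eq_range, List.map_map]
    refine List.map_congr_left fun b _ => ?_
    rw [Function.comp_apply, Bool.eq_iff_iff, matrixEntry_iff, decide_eq_true_eq]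

theorem isInput_encodeDigraph (K : ℕ) : IsInput (encodeDigraph G K) n K (matrixEntry G) := by
  rw [encodeDigraph_eq]
  set M := (List.range n).flatMap fun a => (List.range n).map fun b => matrixEntry G a b with hM
  have hlen : M.length = n * n := by simp [hM, List.length_flatMap]
  constructor
  · simp [hlen]
    omega
  · intro k hk
    rw [List.getElem?_append_left (by simpa using hk)]
    simp [hk]
  · rw [List.getElem?_append_right (by simp)]
    simp
  · intro a ha b hb
    have hlt : a * n + b < n * n := by nlinarith
    rw [List.getElem?_append_right (by simp; omega), List.length_replicate,
      show n + 1 + (a * n + b) - n = a * n + b + 1 by omega, List.singleton_append,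
      List.getElem?_cons_succ, List.getElem?_append_left (by omega), hM,
      getElem?_flatMap_range (by simp) ha hb]
    simp [hb]
  · intro k hk
    rw [List.getElem?_append_right (by simp; omega), List.length_replicate,
      show n + 1 + n * n + k - n = n * n + k + 1 by omega, List.singleton_append,
      List.getElem?_cons_succ, List.getElem?_append_right (by omega), hlen,
      Nat.add_sub_cancel_left]
    simp [hk]

end Reduction

theorem FASInstance.one_le_numArcs (x : FASInstance) : 1 ≤ numArcs x.G := by
  have hn : 0 < x.n := x.one_le.trans x.le_card
  obtain ⟨s, hs, -⟩ := x.restricted.exists_arc ⟨0, hn⟩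
  have : Nonempty (Arc x.G) := ⟨⟨s, hs⟩⟩
  exact Nat.card_pos

/-- The reduction. -/
noncomputable def reduction (x : FASInstance) : AHPInstance where
  n := (vertexList x.G).length
  G := reductionDigraph x.G
  K := x.K + x.n * (numArcs x.G + 1)
  acyclic := by
    intro m c hc
    exact isAcyclic_P x.G (arcNumber x.G) m (fun i => reductionIso x.G (c i))
      ⟨(reductionIso x.G).injective.comp hc.1, hc.2⟩
  one_le := x.one_le.trans (Nat.le_add_right _ _)
  le_card := by
    have h1 := x.one_le_numArcs
    have h2 := x.le_card
    rw [length_vertexList]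
    -- With m ≥ 1 arcs, K ≤ n ≤ n(m+1)m; adding n(m+1) gives at most n(m+1)².
    nlinarith [Nat.mul_le_mul_left x.n (Nat.mul_le_mul_left (numArcs x.G + 1) h1)]

theorem isLogspaceReduction_reduction :
    IsLogspaceReduction restrictedFAS acyclicHamiltonianPartition reduction := by
  constructor
  · obtain ⟨M, C, h⟩ := exists_machine
    refine ⟨M, C, fun x => ?_⟩
    have := h _ _ _ _ (isInput_encodeDigraph x.G x.K)
    rwa [arcCount_eq_numArcs, ← encode_reductionDigraph] at this
  · intro x
    have h := hasFeedbackArcSet_iff x.restricted (isArcNumbering_arcNumber x.G) x.K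
    rw [Nat.card_fin] at h
    exact h.trans ⟨.of_relIso (reductionIso x.G).symm, .of_relIso (reductionIso x.G)⟩

end AHP

theorem mainTheorem2 :
    (∀ (V : Type*) [Finite V] [Nonempty V] (G : Digraph V), AHP.IsRestricted G →
      ∀ e : AHP.Arc G → ℕ, AHP.IsArcNumbering G e →
        AHP.IsAcyclic (AHP.P G e) ∧
        ∀ k : ℕ, AHP.HasFeedbackArcSet G k ↔
          AHP.HasAcyclicHamiltonianPartition (AHP.P G e)
            (k + Nat.card V * (AHP.numArcs G + 1))) ∧
    ∃ f : AHP.FASInstance → AHP.AHPInstance,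
      AHP.IsLogspaceReduction AHP.restrictedFAS AHP.acyclicHamiltonianPartition f ∧
      ∀ x : AHP.FASInstance,
        (f x).K = x.K + x.n * (AHP.numArcs x.G + 1) ∧
        ∃ e : AHP.Arc x.G → ℕ, AHP.IsArcNumbering x.G e ∧
          Nonempty ((f x).G.Adj ≃r (AHP.P x.G e).Adj) :=
  ⟨fun _ _ _ G hG e he => ⟨AHP.isAcyclic_P G e, AHP.hasFeedbackArcSet_iff hG he⟩,
    AHP.reduction, AHP.isLogspaceReduction_reduction, fun x =>
      ⟨rfl, AHP.arcNumber x.G, AHP.isArcNumbering_arcNumber x.G, ⟨AHP.reductionIso x.G⟩⟩⟩
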